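/- Let $Q$ be a finite connected quiver and $d\in\mathbb{N}^{Q_0}$ a dimension vector such that $(Q,d)$ defines a linear free divisor $D$. That is: $d_i\ge 1$ for all vertices $i$; the divisor $D\subset \mathrm{Rep}(Q,d)=\bigoplus_{i\to j}\mathrm{Mat}_{d_j\times d_i}(\mathbb{C})$ is the discriminant (the complement of the open orbit) of the action $(g_i)\cdot(x_\alpha)=(g_{t\alpha}x_\alpha g_{s\alpha}^{-1})$ of $\mathrm{GL}(Q,d)=\prod_i\mathrm{GL}_{d_i}(\mathbb{C})$; the module $\mathrm{Der}(-\log D)$ of logarithmic vector fields along the reduced hypersurface $D$ is free with a basis of linear vector fields; and the largest connected subgroup of $\mathrm{GL}(\mathrm{Rep}(Q,d))$ preserving $D$ is $\mathrm{PGL}(Q,d)=\mathrm{GL}(Q,d)/\mathbb{C}^*\mathrm{id}$. Let $M\in D$ be a point whose corresponding representation of $Q$ is not regular, i.e. has an indecomposable direct summand $N$ which is preprojective ($\tau^kN$ is a nonzero projective $\mathbb{C}Q$-module for some $k\ge 0$, where $\tau N=\mathrm{Hom}_{\mathbb{C}}(\mathrm{Ext}^1_{\mathbb{C}Q}(N,\mathbb{C}Q),\mathbb{C})$)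 or preinjective ($\tau'^kN$ is a nonzero injective $\mathbb{C}Q$-module for some $k\ge0$, where $\tau' N=\mathrm{Ext}^1(\mathrm{Hom}_{\mathbb{C}}(N,\mathbb{C}),\mathbb{C}Q)$, the $\mathrm{Ext}$ being taken over right $\mathbb{C}Q$-modules). Then $D$ is weakly quasihomogeneous at $M$: in coordinates $x_1,\dots,x_n$ of $\mathrm{Rep}(Q,d)$ centred at $M$, there are a local defining equation $f$ of $D$ at $M$ (a generator of the ideal of $D$ in the local ring $\mathcal{O}_M$ of regular functions at $M$) and a matrix $A=(A_{ij})$ with entries in $\mathcal{O}_M$ such that $$f=\sum_{i,j=1}^n x_i\,A_{ij}\,\frac{\partial f}{\partial x_j}$$ and all eigenvalues of the complex matrix $A(0)$ (the value of $A$ at $M$) are non-negative real numbers. -/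

import Mathlib

/-! ## Local rings and logarithmic vector fields on affine space -/

noncomputable section AffineSpace

open MvPolynomial

variable {ι : Type}

instance evalKerIsPrime (p : ι → ℂ) : (RingHom.ker (MvPolynomial.eval p)).IsPrime :=
  RingHom.ker_isPrime _

/-- The local ring of regular functions at the point `p` of the affine space `ℂ^ι`:
the polynomial ring localized at the maximal ideal of polynomials vanishing at `p`. -/
abbrev LocalRingAt (p : ι → ℂ) : Type :=
  Localization.AtPrime (RingHom.ker (MvPolynomial.eval p))

/-- The value at `p` of a germ of a regular function. -/
def valueAt (p : ι → ℂ) : LocalRingAt p →+* ℂ :=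
  IsLocalization.lift (M := (RingHom.ker (MvPolynomial.eval p)).primeCompl)
    (g := MvPolynomial.eval p) (fun y => isUnit_iff_ne_zero.mpr y.2)

/-- The partial derivative `∂/∂x_j` on germs, given on a fraction `a / b` by the quotient rule.
It does not depend on the fraction chosen to represent the germ, see `partialAt_mk`. -/
def partialAt (p : ι → ℂ) (j : ι) (F : LocalRingAt p) : LocalRingAt p :=
  let ab := IsLocalization.sec (RingHom.ker (MvPolynomial.eval p)).primeCompl F
  Localization.mk (ab.2 * pderiv j ab.1 - ab.1 * pderiv j (ab.2 : MvPolynomial ι ℂ)) (ab.2 * ab.2)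

theorem quotientRule_aux (j : ι) (a b u v : MvPolynomial ι ℂ) (h : b * u = v * a) :
    b * b * (v * pderiv j u - u * pderiv j v) = v * v * (b * pderiv j a - a * pderiv j b) := by
  have h2 := congrArg (pderiv j) h
  simp only [Derivation.leibniz, smul_eq_mul] at h2
  linear_combination b * v * h2 - (b * pderiv j v + v * pderiv j b) * h

theorem partialAt_mk (p : ι → ℂ) (j : ι) (a : MvPolynomial ι ℂ)
    (b : (RingHom.ker (MvPolynomial.eval p)).primeCompl) :
    partialAt p j (Localization.mk a b) =
      Localization.mk ((b : MvPolynomial ι ℂ) * pderiv j a - a * pderiv j (b : MvPolynomial ι ℂ))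
        (b * b) := by
  have hs := IsLocalization.mk'_sec (M := (RingHom.ker (MvPolynomial.eval p)).primeCompl)
    (LocalRingAt p) (Localization.mk a b)
  unfold partialAt
  generalize IsLocalization.sec (RingHom.ker (MvPolynomial.eval p)).primeCompl
    (Localization.mk a b : LocalRingAt p) = u at hs ⊢
  obtain ⟨u, v⟩ := u
  rw [Localization.mk_eq_mk', IsLocalization.mk'_eq_iff_eq] at hs
  have h1 := IsLocalization.injective (LocalRingAt p)
    (Ideal.primeCompl_le_nonZeroDivisors (RingHom.ker (MvPolynomial.eval p))) hs
  have h2 := quotientRule_aux j a b u v h1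
  dsimp only
  rw [Localization.mk_eq_mk', IsLocalization.mk'_eq_iff_eq]
  exact congrArg _ h2

variable [Fintype ι] [DecidableEq ι]

/-- The vanishing ideal `I(D)` of a subset `D` of `ℂ^ι` in the polynomial ring. -/
abbrev idealOf (D : Set (ι → ℂ)) : Ideal (MvPolynomial ι ℂ) :=
  MvPolynomial.vanishingIdeal ℂ D

/-- `D` is an (algebraic, reduced) hypersurface: the zero set of one nonzero polynomial. -/
def IsHypersurface (D : Set (ι → ℂ)) : Prop :=
  ∃ f : MvPolynomial ι ℂ, f ≠ 0 ∧ D = {x | MvPolynomial.eval x f = 0}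

/-- The module `Der(-log D)` of logarithmic vector fields along `D`: the polynomial vector fields
`δ` with `δ(I(D)) ⊆ I(D)`.  As affine space is affine, this module of global sections determines
the (coherent) sheaf of logarithmic vector fields. -/
def logDer (D : Set (ι → ℂ)) :
    Submodule (MvPolynomial ι ℂ) (Derivation ℂ (MvPolynomial ι ℂ) (MvPolynomial ι ℂ)) where
  carrier := {δ | ∀ f ∈ idealOf D, δ f ∈ idealOf D}
  add_mem' hδ hε f hf := add_mem (hδ f hf) (hε f hf)
  zero_mem' _ _ := zero_mem _
  smul_mem' c _ hδ f hf := Ideal.mul_mem_left _ c (hδ f hf)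

/-- A vector field is linear if its coefficients are linear forms. -/
def IsLinearVectorField (δ : Derivation ℂ (MvPolynomial ι ℂ) (MvPolynomial ι ℂ)) : Prop :=
  ∀ j, (δ (X j)).IsHomogeneous 1

/-- `D` is a linear free divisor: a reduced hypersurface whose module of logarithmic vector fields
is free with a basis of linear vector fields. -/
def IsLinearFreeDivisor (D : Set (ι → ℂ)) : Prop :=
  IsHypersurface D ∧
    ∃ b : Module.Basis ι (MvPolynomial ι ℂ) (logDer D), ∀ k, IsLinearVectorField (b k).1

/-- `f` is a local defining equation of the reduced hypersurface `D` at `p`: it generates the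
stalk at `p` of the ideal of `D`. -/
def IsLocalEquation (D : Set (ι → ℂ)) (p : ι → ℂ) (f : LocalRingAt p) : Prop :=
  Ideal.span {f} = (idealOf D).map (algebraMap (MvPolynomial ι ℂ) (LocalRingAt p))

/-- `D` is weakly quasihomogeneous at `p`: with the coordinates `x_i - p_i` centred at `p`, some
local equation satisfies `f = ∑ (x_i - p_i) A_ij ∂f/∂x_j`, where all eigenvalues of the complex
matrix `A(p)` are non-negative real numbers. -/
def IsWeaklyQuasihomogeneousAt (D : Set (ι → ℂ)) (p : ι → ℂ) : Prop :=
  ∃ f : LocalRingAt p, IsLocalEquation D p f ∧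
    ∃ A : Matrix ι ι (LocalRingAt p),
      f = ∑ i, ∑ j, algebraMap (MvPolynomial ι ℂ) (LocalRingAt p) (X i - C (p i)) * A i j *
        partialAt p j f ∧
      ∀ μ ∈ spectrum ℂ (A.map (valueAt p)), ∃ r : ℝ, 0 ≤ r ∧ μ = (r : ℂ)

/-- `H` is the largest connected subgroup of `GL(ℂ^ι)` preserving `D`. -/
def IsLargestConnectedSubgroupPreserving (D : Set (ι → ℂ)) (H : Subgroup (GL ι ℂ)) : Prop :=
  IsGreatest {K : Subgroup (GL ι ℂ) |
    IsConnected (K : Set (GL ι ℂ)) ∧ ∀ g ∈ K, (fun x => g.1.mulVec x) '' D = D} H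

end AffineSpace

/-! ## Representations of a quiver -/

/-- A representation over `ℂ` of the quiver `Q` (of arbitrary dimension); for `Q` with finitely many
vertices this is the same as a left module over the path algebra `ℂQ`. -/
structure QRep (Q : Type) [Quiver.{0} Q] where
  V : Q → Type
  [addCommGroup : ∀ i, AddCommGroup (V i)]
  [module : ∀ i, Module ℂ (V i)]
  map : ∀ {i j : Q}, (i ⟶ j) → V i →ₗ[ℂ] V j

namespace QRep

noncomputable section

attribute [instance] QRep.addCommGroup QRep.module

variable {Q : Type} [Quiver.{0} Q]

/-- Homomorphisms of representations. -/
structure Hom (M N : QRep Q) where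
  app : ∀ i, M.V i →ₗ[ℂ] N.V i
  comm : ∀ {i j : Q} (a : i ⟶ j), N.map a ∘ₗ app i = app j ∘ₗ M.map a

/-- Two representations are isomorphic. -/
def IsIso (M N : QRep Q) : Prop := ∃ φ : Hom M N, ∀ i, Function.Bijective (φ.app i)

/-- The representation is zero. -/
def IsZero (M : QRep Q) : Prop := ∀ i, Subsingleton (M.V i)

/-- The direct sum `M ⊕ N`. -/
def sum (M N : QRep Q) : QRep Q where
  V i := M.V i × N.V i
  map a := LinearMap.prodMap (M.map a) (N.map a)

/-- `M` is indecomposable. -/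
def IsIndecomposable (M : QRep Q) : Prop :=
  ¬ M.IsZero ∧ ∀ A B : QRep Q, IsIso M (A.sum B) → A.IsZero ∨ B.IsZero

/-- `N` is (isomorphic to) a direct summand of `M`. -/
def IsSummand (N M : QRep Q) : Prop := ∃ N' : QRep Q, IsIso M (N.sum N')

/-- `M` is projective as a `ℂQ`-module. -/
def IsProjective (M : QRep Q) : Prop :=
  ∀ (A B : QRep Q) (g : Hom A B) (h : Hom M B), (∀ i, Function.Surjective (g.app i)) →
    ∃ l : Hom M A, ∀ i, g.app i ∘ₗ l.app i = h.app i

/-- `M` is injective as a `ℂQ`-module. -/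
def IsInjective (M : QRep Q) : Prop :=
  ∀ (A B : QRep Q) (g : Hom A B) (h : Hom A M), (∀ i, Function.Injective (g.app i)) →
    ∃ l : Hom B M, ∀ i, l.app i ∘ₗ g.app i = h.app i

/-- The map `c_{M,N} : ∏_i Hom(M_i, N_i) → ∏_{a : i → j} Hom(M_i, N_j)`,
`φ ↦ (φ_j M_a - N_a φ_i)_a`, obtained by applying `Hom_Q(-, N)` to the standard projective
resolution of `M`. -/
def ringel (M N : QRep Q) :
    (∀ i, M.V i →ₗ[ℂ] N.V i) →ₗ[ℂ] (∀ (i j : Q) (_ : i ⟶ j), M.V i →ₗ[ℂ] N.V j) where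
  toFun φ := fun i j a => φ j ∘ₗ M.map a - N.map a ∘ₗ φ i
  map_add' φ ψ := by
    funext i j a
    ext v
    simp only [Pi.add_apply, LinearMap.sub_apply, LinearMap.add_apply, LinearMap.comp_apply,
      map_add]
    abel
  map_smul' c φ := by
    funext i j a
    ext v
    simp [smul_sub]

/-- `Ext_Q(M, N) = Ext^1(M, N)`, computed by the standard projective resolution of `M`: the
cokernel of `c_{M,N}`. -/
abbrev Ext (M N : QRep Q) : Type :=
  (∀ (i j : Q) (_ : i ⟶ j), M.V i →ₗ[ℂ] N.V j) ⧸ LinearMap.range (ringel M N)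

/-- Postcomposition with `φ : N ⟶ N'` on families indexed by the arrows. -/
def postcomp (M : QRep Q) {N N' : QRep Q} (φ : Hom N N') :
    (∀ (i j : Q) (_ : i ⟶ j), M.V i →ₗ[ℂ] N.V j) →ₗ[ℂ]
      (∀ (i j : Q) (_ : i ⟶ j), M.V i →ₗ[ℂ] N'.V j) where
  toFun θ := fun i j a => φ.app j ∘ₗ θ i j a
  map_add' θ η := by
    funext i j a
    ext v
    simp
  map_smul' c θ := by
    funext i j a
    ext v
    simp

/-- Functoriality of `Ext_Q(M, N)` in `N`. -/
def extMap (M : QRep Q) {N N' : QRep Q} (φ : Hom N N') : Ext M N →ₗ[ℂ] Ext M N' :=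
  Submodule.mapQ _ _ (postcomp M φ) (by
    rintro _ ⟨ψ, rfl⟩
    refine ⟨fun i => φ.app i ∘ₗ ψ i, ?_⟩
    funext i j a
    ext v
    have h := LinearMap.congr_fun (φ.comm a) (ψ i v)
    simp only [LinearMap.comp_apply] at h
    simp [ringel, postcomp, h])

/-- The representation `P(i) = ℂQ e_i`, spanned by the paths starting at `i`. -/
def P (i : Q) : QRep Q where
  V k := Quiver.Path i k →₀ ℂ
  map a := Finsupp.lmapDomain ℂ ℂ (fun p => p.cons a)

/-- Right multiplication by the arrow `a : i → j` on the path algebra, `ℂQ e_j → ℂQ e_i`. -/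
def PMap {i j : Q} (a : i ⟶ j) : Hom (P j) (P i) where
  app _ := Finsupp.lmapDomain ℂ ℂ (fun p => a.toPath.comp p)
  comm b := by
    have h : ∀ {k l : Q} (b : k ⟶ l),
        Finsupp.lmapDomain ℂ ℂ (fun p : Quiver.Path i k => p.cons b) ∘ₗ
          Finsupp.lmapDomain ℂ ℂ (fun p : Quiver.Path j k => a.toPath.comp p) =
        Finsupp.lmapDomain ℂ ℂ (fun p : Quiver.Path j l => a.toPath.comp p) ∘ₗ
          Finsupp.lmapDomain ℂ ℂ (fun p : Quiver.Path j k => p.cons b) := by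
      intro k l b
      ext p : 2
      simp [Finsupp.mapDomain_single]
    exact h b

/-- The Auslander-Reiten translate `τ M = D Ext(M, ℂQ)`, where `D = Hom_ℂ(-, ℂ)`.  At the vertex
`i` the right module `Ext(M, ℂQ)` is `Ext(M, ℂQ) e_i = Ext(M, P(i))`. -/
def tau (M : QRep Q) : QRep Q where
  V i := Module.Dual ℂ (Ext M (P i))
  map a := (extMap M (PMap a)).dualMap

/-- The dual `D M = Hom_ℂ(M, ℂ)`, a right `ℂQ`-module, i.e. a representation of the
opposite quiver. -/
def dual (M : QRep Q) : QRep Qᵒᵖ where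
  V i := Module.Dual ℂ (M.V i.unop)
  map a := (M.map a.unop).dualMap

/-- The inverse translate `τ' M = Ext(D M, ℂQ)`, with `Ext` of right `ℂQ`-modules.  At the vertex
`i` it is `Ext(D M, e_i ℂQ)`, and `e_i ℂQ` is the representation `P(i)` of the opposite quiver. -/
def tauInv (M : QRep Q) : QRep Q where
  V i := Ext (dual M) (P (Opposite.op i))
  map a := extMap (dual M) (PMap a.op)

/-- `M` is preprojective: some `τ^k M` is a nonzero projective. -/
def IsPreprojective (M : QRep Q) : Prop :=
  ∃ k : ℕ, ¬ (tau^[k] M).IsZero ∧ (tau^[k] M).IsProjective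

/-- `M` is preinjective: some `τ'^k M` is a nonzero injective. -/
def IsPreinjective (M : QRep Q) : Prop :=
  ∃ k : ℕ, ¬ (tauInv^[k] M).IsZero ∧ (tauInv^[k] M).IsInjective

/-- `M` is regular: it has no preprojective or preinjective indecomposable summand. -/
def IsRegular (M : QRep Q) : Prop :=
  ∀ N : QRep Q, N.IsIndecomposable → IsSummand N M → ¬ N.IsPreprojective ∧ ¬ N.IsPreinjective

end

end QRep

/-! ## Representation spaces and quiver linear free divisors -/

noncomputable section RepSpace

variable {Q : Type} [Quiver.{0} Q]

/-- The quiver is a (nonempty) connected graph. -/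
def IsConnectedQuiver (Q : Type) [Quiver.{0} Q] : Prop :=
  Nonempty Q ∧ Subsingleton (Quiver.WeaklyConnectedComponent Q)

/-- Index set of the coordinates on `Rep(Q, d)`: an arrow `i → j` with the row and column index of
an entry of a `d_j × d_i` matrix. -/
abbrev RepCoord (Q : Type) [Quiver.{0} Q] (d : Q → ℕ) : Type :=
  Σ (i j : Q) (_ : i ⟶ j), Fin (d j) × Fin (d i)

/-- The representation space `Rep(Q, d) = ⊕_{i → j} Mat_{d_j × d_i}(ℂ)`, in coordinates. -/
abbrev RepSpace (Q : Type) [Quiver.{0} Q] (d : Q → ℕ) : Type := RepCoord Q d → ℂ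

/-- The matrix of the arrow `a` in the representation `x`. -/
def RepSpace.mat {d : Q → ℕ} (x : RepSpace Q d) {i j : Q} (a : i ⟶ j) :
    Matrix (Fin (d j)) (Fin (d i)) ℂ :=
  Matrix.of fun k l => x ⟨i, j, a, k, l⟩

/-- The point `x` as a representation with the spaces `ℂ^{d_i}`. -/
def RepSpace.toQRep {d : Q → ℕ} (x : RepSpace Q d) : QRep Q where
  V i := Fin (d i) → ℂ
  map a := (RepSpace.mat x a).mulVecLin

/-- The action `(g x)_a = g_j x_a g_i⁻¹` (for `a : i → j`) of `GL(Q, d) = ∏_i GL_{d_i}(ℂ)` on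
`Rep(Q, d)`. -/
def RepSpace.act {d : Q → ℕ} (g : ∀ i, GL (Fin (d i)) ℂ) (x : RepSpace Q d) : RepSpace Q d :=
  fun c => ((g c.2.1).1 * RepSpace.mat x c.2.2.1 * ((g c.1)⁻¹).1) c.2.2.2.1 c.2.2.2.2

/-- `(Q, d)` defines the linear free divisor `D`: the dimension vector `d` is sincere; `D` is the
discriminant of the action of `GL(Q, d)` on `Rep(Q, d)`, i.e. the complement of an open orbit
(openness is automatic as `D` is a hypersurface); `D` is a linear free divisor; and its associated
group, the largest connected subgroup of `GL(Rep(Q, d))` preserving `D`, is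
`PGL(Q, d) = GL(Q, d) / ℂ^* id` acting on `Rep(Q, d)`. -/
structure DefinesLinearFreeDivisor [Fintype Q] [DecidableEq Q] [∀ i j : Q, Fintype (i ⟶ j)]
    [∀ i j : Q, DecidableEq (i ⟶ j)] (d : Q → ℕ) (D : Set (RepSpace Q d)) : Prop where
  sincere : ∀ i, 1 ≤ d i
  discriminant : ∃ x₀ : RepSpace Q d, Dᶜ = Set.range fun g => RepSpace.act g x₀
  linearFree : IsLinearFreeDivisor D
  group_image : ∃ H : Subgroup (GL (RepCoord Q d) ℂ), IsLargestConnectedSubgroupPreserving D H ∧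
    ∀ h : GL (RepCoord Q d) ℂ, h ∈ H ↔
      ∃ g : ∀ i, GL (Fin (d i)) ℂ, ∀ x : RepSpace Q d, h.1.mulVec x = RepSpace.act g x
  group_kernel : ∀ g : ∀ i, GL (Fin (d i)) ℂ,
    (∀ x : RepSpace Q d, RepSpace.act g x = x) ↔
      ∃ c : ℂ, ∀ i, (g i).1 = c • (1 : Matrix (Fin (d i)) (Fin (d i)) ℂ)

end RepSpace

/-!
Let `τ` be the Auslander-Reiten translate. It is left exact, so the representations killed by `τᵏ`
are the torsion-free part of a torsion pair, and a preprojective module is killed by some `τᵏ`.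
Hence, up to duality, a representation `M` that is not regular has a nonzero quotient killed by
`τᵏ`; take the least such `k`. If `U` is the torsion part of `M` and `U ≠ 0`, then
`Hom(U, M/U) = 0`, and `Ext(M/U, U)`, which is dual to `Hom(U, τ(M/U))`, vanishes as well, so that
`M = A ⊕ B` with `A, B ≠ 0`, `Ext(A, B) = 0` and `Hom(B, A) = 0`. If `U = 0`, then
`Hom(M, τM) = 0` by minimality of `k`, hence `Ext(M, M) = 0` and `M` lies in the open orbit, not
in `D`.

The projection `e` to `A` acts on `Rep(Q,d)` by a linear vector field that vanishes at `M` and has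
eigenvalues `1` on the block `Rep(B, A)`, `-1` on `Rep(A, B)` and `0` on the others. By Saito's
criterion it multiplies a reduced equation `f` of `D` by its trace `χ = dim Rep(B, A) -
dim Rep(A, B)`. The infinitesimal action at `M` maps `Hom(B, A)` injectively to `Rep(B, A)` and
`Hom(A, B)` onto `Rep(A, B)` (here `Hom` stands for families of linear maps between the vector
spaces at the vertices), and these two spaces of families have the same dimension, so `χ ≥ 0`. If
`χ = 0`, then both maps are bijective and `M + ker e` meets every orbit near `M`, so `e` fixes a
point of the open orbit, where the isotropy algebra consists of the scalars: a contradiction.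

The field of `e` over `χ` has the eigenvalue `-1/χ` on `Rep(A, B)`. These directions are tangent to
the orbit of `M`, so adding fields `(xᵢ - Mᵢ) Rᵢ` with `Rᵢ` coming from the action makes the linear
part idempotent before division by `χ`. This changes the multiplier of `f` only by a function
vanishing at `M`.
-/

theorem exists_comp_eq_of_ker_le_ker {K V W U : Type*} [Field K] [AddCommGroup V] [AddCommGroup W]
    [AddCommGroup U] [Module K V] [Module K W] [Module K U] {g : V →ₗ[K] W} {f : V →ₗ[K] U}
    (h : LinearMap.ker g ≤ LinearMap.ker f) : ∃ k : W →ₗ[K] U, k ∘ₗ g = f := by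
  obtain ⟨k, hk⟩ :=
    LinearMap.exists_extend ((LinearMap.ker g).liftQ f h ∘ₗ g.quotKerEquivRange.symm.toLinearMap)
  refine ⟨k, LinearMap.ext fun v => ?_⟩
  have hkv := LinearMap.congr_fun hk (g.quotKerEquivRange (Submodule.Quotient.mk v))
  simpa using hkv

theorem exact_dualMap {K V W U : Type*} [Field K] [AddCommGroup V] [AddCommGroup W]
    [AddCommGroup U] [Module K V] [Module K W] [Module K U] {f : V →ₗ[K] W} {g : W →ₗ[K] U}
    (h : Function.Exact f g) : Function.Exact g.dualMap f.dualMap :=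
  LinearMap.exact_iff.mpr <| by
    rw [LinearMap.ker_dualMap_eq_dualAnnihilator_range,
      LinearMap.range_dualMap_eq_dualAnnihilator_ker, LinearMap.exact_iff.mp h]

namespace QRep

variable {Q : Type} [Quiver.{0} Q]

theorem Hom.comm_apply {A B : QRep Q} (f : Hom A B) {i j : Q} (a : i ⟶ j) (v : A.V i) :
    B.map a (f.app i v) = f.app j (A.map a v) :=
  LinearMap.congr_fun (f.comm a) v

/-- The composition of homomorphisms of representations. -/
def Hom.comp {A B C : QRep Q} (g : Hom B C) (f : Hom A B) : Hom A C where
  app i := g.app i ∘ₗ f.app i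
  comm a := LinearMap.ext fun v => by simp only [LinearMap.comp_apply, Hom.comm_apply]

/-- The identity homomorphism. -/
def Hom.id (A : QRep Q) : Hom A A where
  app _ := LinearMap.id
  comm _ := rfl

/-- `Hom(A, B) = 0`. -/
def HomVanishes (A B : QRep Q) : Prop :=
  ∀ (f : Hom A B) (i : Q), f.app i = 0

/-! ### The functor `Ext` -/

/-- The families of linear maps `A_i → B_j` indexed by the arrows `i → j`: the 1-cochains of the
complex `ringel A B` whose cokernel is `Ext(A, B)`. -/
abbrev ArrowFamily (A B : QRep Q) : Type :=
  ∀ (i j : Q) (_ : i ⟶ j), A.V i →ₗ[ℂ] B.V j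

theorem ArrowFamily.ext {A B : QRep Q} {θ η : ArrowFamily A B}
    (h : ∀ {i j : Q} (a : i ⟶ j) (v : A.V i), θ i j a v = η i j a v) : θ = η :=
  funext fun _ => funext fun _ => funext fun a => LinearMap.ext (h a)

@[simp] theorem ringel_apply (A B : QRep Q) (φ : ∀ i, A.V i →ₗ[ℂ] B.V i) {i j : Q} (a : i ⟶ j)
    (v : A.V i) : ringel A B φ i j a v = φ j (A.map a v) - B.map a (φ i v) := rfl

@[simp] theorem postcomp_apply (A : QRep Q) {B C : QRep Q} (g : Hom B C) (θ : ArrowFamily A B)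
    {i j : Q} (a : i ⟶ j) : postcomp A g θ i j a = g.app j ∘ₗ θ i j a := rfl

/-- Precomposition with `f : A ⟶ B` on families indexed by the arrows. -/
def precomp {A B : QRep Q} (f : Hom A B) (N : QRep Q) : ArrowFamily B N →ₗ[ℂ] ArrowFamily A N where
  toFun θ := fun i j a => θ i j a ∘ₗ f.app i
  map_add' _ _ := rfl
  map_smul' _ _ := rfl

@[simp] theorem precomp_apply {A B : QRep Q} (f : Hom A B) (N : QRep Q) (θ : ArrowFamily B N)
    {i j : Q} (a : i ⟶ j) : precomp f N θ i j a = θ i j a ∘ₗ f.app i := rfl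

theorem precomp_ringel {A B : QRep Q} (f : Hom A B) (N : QRep Q) (ψ : ∀ i, B.V i →ₗ[ℂ] N.V i) :
    precomp f N (ringel B N ψ) = ringel A N fun i => ψ i ∘ₗ f.app i :=
  ArrowFamily.ext fun a v => by
    simp only [precomp_apply, LinearMap.comp_apply, ringel_apply, Hom.comm_apply]

/-- Functoriality of `Ext_Q(M, N)` in `M`. -/
def extMapLeft {A B : QRep Q} (f : Hom A B) (N : QRep Q) : Ext B N →ₗ[ℂ] Ext A N :=
  Submodule.mapQ _ _ (precomp f N) (by
    rintro _ ⟨ψ, rfl⟩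
    exact ⟨_, (precomp_ringel f N ψ).symm⟩)

theorem subsingleton_ext_iff {A B : QRep Q} :
    Subsingleton (Ext A B) ↔ Function.Surjective (ringel A B) :=
  Submodule.Quotient.subsingleton_iff.trans LinearMap.range_eq_top

theorem extMapLeft_surjective {A B : QRep Q} {f : Hom A B} (hf : ∀ i, Function.Injective (f.app i))
    (N : QRep Q) : Function.Surjective (extMapLeft f N) := by
  intro e
  obtain ⟨θ, rfl⟩ := Submodule.Quotient.mk_surjective _ e
  choose r hr using fun i =>
    (f.app i).exists_leftInverse_of_injective (LinearMap.ker_eq_bot.mpr (hf i))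
  refine ⟨Submodule.Quotient.mk fun i j a => θ i j a ∘ₗ r i, congrArg Submodule.Quotient.mk ?_⟩
  exact ArrowFamily.ext fun {i j} a v => congrArg (θ i j a) (LinearMap.congr_fun (hr i) v)

theorem exact_extMapLeft {A B C : QRep Q} {f : Hom A B} {g : Hom B C}
    (hf : ∀ i, Function.Injective (f.app i)) (hfg : ∀ i, Function.Exact (f.app i) (g.app i))
    (N : QRep Q) : Function.Exact (extMapLeft g N) (extMapLeft f N) := by
  intro e
  obtain ⟨η, rfl⟩ := Submodule.Quotient.mk_surjective _ e
  constructor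
  · intro he
    obtain ⟨ψ, hψ⟩ := (Submodule.Quotient.mk_eq_zero _).mp he
    choose r hr using fun i =>
      (f.app i).exists_leftInverse_of_injective (LinearMap.ker_eq_bot.mpr (hf i))
    -- Correcting the cocycle by the coboundary of an extension of `ψ` makes it vanish on `A`.
    let η' : ArrowFamily B N := η - ringel B N fun i => ψ i ∘ₗ r i
    have hη' : precomp f N η' = 0 := by
      have hψr : (fun i => (ψ i ∘ₗ r i) ∘ₗ f.app i) = ψ := funext fun i => by
        rw [LinearMap.comp_assoc, hr, LinearMap.comp_id]
      rw [map_sub, precomp_ringel, hψr, hψ, sub_self]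
    have hker : ∀ {i j : Q} (a : i ⟶ j), LinearMap.ker (g.app i) ≤ LinearMap.ker (η' i j a) := by
      intro i j a v hv
      obtain ⟨w, rfl⟩ := (hfg i v).mp hv
      exact LinearMap.congr_fun (congrFun (congrFun (congrFun hη' i) j) a) w
    choose θ hθ using fun i j a => exists_comp_eq_of_ker_le_ker (@hker i j a)
    have hgθ : precomp g N θ = η' := funext fun i => funext fun j => funext (hθ i j)
    refine ⟨Submodule.Quotient.mk θ, (Submodule.Quotient.eq _).mpr ?_⟩
    rw [hgθ, sub_sub_cancel_left]
    exact neg_mem (LinearMap.mem_range_self _ _)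
  · rintro ⟨e, he⟩
    obtain ⟨θ, rfl⟩ := Submodule.Quotient.mk_surjective _ e
    rw [← he]
    refine congrArg Submodule.Quotient.mk (ArrowFamily.ext fun {i j} a v => ?_)
    exact (congrArg (θ i j a) ((hfg i).apply_apply_eq_zero v)).trans (map_zero _)

/-! ### Left exactness of the Auslander-Reiten translate -/

/-- The sequence `0 → A → B → C` is exact for suitable homomorphisms. -/
def LeftExact (A B C : QRep Q) : Prop :=
  ∃ (f : Hom A B) (g : Hom B C), (∀ i, Function.Injective (f.app i)) ∧
    ∀ i, Function.Exact (f.app i) (g.app i)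

/-- Functoriality of the Auslander-Reiten translate. -/
noncomputable def tauHom {A B : QRep Q} (f : Hom A B) : Hom (tau A) (tau B) where
  app i := (extMapLeft f (P i)).dualMap
  comm _ := LinearMap.ext fun _ => LinearMap.ext fun e => by
    obtain ⟨_, rfl⟩ := Submodule.Quotient.mk_surjective _ e
    rfl

theorem LeftExact.tau {A B C : QRep Q} (h : LeftExact A B C) :
    LeftExact (tau A) (tau B) (tau C) := by
  obtain ⟨f, g, hf, hfg⟩ := h
  exact ⟨tauHom f, tauHom g,
    fun i => LinearMap.dualMap_injective_of_surjective (extMapLeft_surjective hf (P i)),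
    fun i => exact_dualMap (exact_extMapLeft hf hfg (P i))⟩

theorem LeftExact.iterate_tau {A B C : QRep Q} (h : LeftExact A B C) (k : ℕ) :
    LeftExact (QRep.tau^[k] A) (QRep.tau^[k] B) (QRep.tau^[k] C) := by
  induction k generalizing A B C with
  | zero => exact h
  | succ _ ih => exact ih h.tau

theorem LeftExact.isZero {A B C : QRep Q} (h : LeftExact A B C) (hA : A.IsZero) (hC : C.IsZero) :
    B.IsZero := by
  obtain ⟨f, g, -, hfg⟩ := h
  intro i
  have := hA i
  have := hC i
  refine subsingleton_of_forall_eq 0 fun v => ?_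
  obtain ⟨w, rfl⟩ := (hfg i v).mp (Subsingleton.elim _ _)
  rw [Subsingleton.elim w 0, map_zero]

theorem IsZero.of_injective {A B : QRep Q} (hB : B.IsZero) {f : Hom A B}
    (hf : ∀ i, Function.Injective (f.app i)) : A.IsZero := fun i =>
  have := hB i
  (hf i).subsingleton

theorem isZero_tau {A : QRep Q} (h : ∀ i, Subsingleton (Ext A (P i))) : A.tau.IsZero := fun i =>
  have := h i
  inferInstanceAs (Subsingleton (Module.Dual ℂ (Ext A (P i))))

theorem IsZero.tau {A : QRep Q} (hA : A.IsZero) : A.tau.IsZero :=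
  have : ∀ i, Subsingleton (A.V i) := hA
  isZero_tau fun _ => (Submodule.Quotient.mk_surjective _).subsingleton

/-! ### Subrepresentations and quotients -/

/-- A family of subspaces is stable under the arrows. -/
def IsStable (M : QRep Q) (U : ∀ i, Submodule ℂ (M.V i)) : Prop :=
  ∀ ⦃i j : Q⦄ (a : i ⟶ j), U i ≤ (U j).comap (M.map a)

variable {M N : QRep Q} {U : ∀ i, Submodule ℂ (M.V i)}

/-- The subrepresentation on a stable family of subspaces. -/
def sub (hU : M.IsStable U) : QRep Q where
  V i := U i
  map a := (M.map a).restrict (hU a)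

/-- The quotient by a stable family of subspaces. -/
def quot (hU : M.IsStable U) : QRep Q where
  V i := M.V i ⧸ U i
  map a := Submodule.mapQ _ _ (M.map a) (hU a)

/-- The inclusion of a subrepresentation. -/
def subIncl (hU : M.IsStable U) : Hom (sub hU) M where
  app i := (U i).subtype
  comm _ := rfl

/-- The projection to a quotient representation. -/
def quotProj (hU : M.IsStable U) : Hom M (quot hU) where
  app i := (U i).mkQ
  comm _ := rfl

theorem Hom.isStable_ker (f : Hom M N) : M.IsStable fun i => LinearMap.ker (f.app i) := by
  intro i j a v hv
  rw [Submodule.mem_comap, LinearMap.mem_ker, ← f.comm_apply, LinearMap.mem_ker.mp hv, map_zero]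

theorem Hom.isStable_range (f : Hom M N) : N.IsStable fun i => LinearMap.range (f.app i) := by
  rintro i j a _ ⟨v, rfl⟩
  exact ⟨M.map a v, (f.comm_apply a v).symm⟩

/-- The homomorphism induced on the quotient by a stable family of subspaces of the kernel. -/
def Hom.descend (f : Hom M N) (hU : M.IsStable U) (h : ∀ i, U i ≤ LinearMap.ker (f.app i)) :
    Hom (quot hU) N where
  app i := (U i).liftQ (f.app i) (h i)
  comm a := LinearMap.ext fun v => by
    obtain ⟨v, rfl⟩ := Submodule.Quotient.mk_surjective _ v
    exact f.comm_apply a v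

theorem Hom.descend_injective (f : Hom M N) (i : Q) :
    Function.Injective ((f.descend f.isStable_ker fun _ => le_rfl).app i) :=
  LinearMap.ker_eq_bot.mp (Submodule.ker_liftQ_eq_bot _ _ _ le_rfl)

/-! ### Torsion-free classes -/

/-- A class of representations that contains the zero representations and is closed under
subrepresentations and extensions. -/
structure IsTorsionFreeClass (F : QRep Q → Prop) : Prop where
  of_isZero : ∀ {A : QRep Q}, A.IsZero → F A
  of_injective : ∀ {A B : QRep Q} {f : Hom A B}, (∀ i, Function.Injective (f.app i)) → F B → F A
  of_leftExact : ∀ {A B C : QRep Q}, LeftExact A B C → F A → F C → F B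

theorem isTorsionFreeClass_iterate_tau (k : ℕ) :
    IsTorsionFreeClass fun A : QRep Q => (tau^[k] A).IsZero where
  of_isZero hA := Function.Iterate.rec _ hA (fun _ => IsZero.tau) k
  of_injective {A B f} hf hB := by
    have h : LeftExact A B (quot f.isStable_range) :=
      ⟨f, quotProj f.isStable_range, hf, fun i => LinearMap.exact_iff.mpr (Submodule.ker_mkQ _)⟩
    obtain ⟨f', _, hf', _⟩ := h.iterate_tau k
    exact IsZero.of_injective hB hf'
  of_leftExact h := (h.iterate_tau k).isZero

/-- The kernel of a homomorphism from the subrepresentation on `U`, as a family of subspaces of the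
ambient representation. -/
abbrev kerIn {hU : M.IsStable U} (f : Hom (sub hU) N) (i : Q) : Submodule ℂ (M.V i) :=
  Submodule.map (U i).subtype (LinearMap.ker (f.app i))

theorem isStable_kerIn {hU : M.IsStable U} (f : Hom (sub hU) N) : M.IsStable (kerIn f) := by
  rintro i j a _ ⟨v, hv, rfl⟩
  exact ⟨(sub hU).map a v, f.isStable_ker a hv, rfl⟩

theorem kerIn_le {hU : M.IsStable U} (f : Hom (sub hU) N) (i : Q) : kerIn f i ≤ U i :=
  Submodule.map_subtype_le _ _

theorem mem_kerIn_iff {hU : M.IsStable U} {f : Hom (sub hU) N} {i : Q} {v : (sub hU).V i} :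
    (subIncl hU).app i v ∈ kerIn f i ↔ f.app i v = 0 :=
  ⟨fun ⟨_, hw, hwv⟩ => Subtype.ext hwv ▸ hw, fun hv => ⟨v, hv, rfl⟩⟩

theorem leftExact_quot_kerIn {hU : M.IsStable U} (f : Hom (sub hU) N) :
    LeftExact (quot f.isStable_ker) (quot (isStable_kerIn f)) (quot hU) := by
  refine ⟨((quotProj (isStable_kerIn f)).comp (subIncl hU)).descend f.isStable_ker
      fun i v hv => (Submodule.Quotient.mk_eq_zero _).mpr (mem_kerIn_iff.mpr hv),
    (quotProj hU).descend (isStable_kerIn f) fun i v hv =>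
      (Submodule.Quotient.mk_eq_zero _).mpr (kerIn_le f i hv),
    fun i => (injective_iff_map_eq_zero _).mpr fun v hv => ?_, fun i v => ?_⟩
  · obtain ⟨v, rfl⟩ := Submodule.Quotient.mk_surjective _ v
    exact (Submodule.Quotient.mk_eq_zero _).mpr
      (mem_kerIn_iff.mp ((Submodule.Quotient.mk_eq_zero _).mp hv))
  · obtain ⟨v, rfl⟩ := Submodule.Quotient.mk_surjective _ v
    constructor
    · exact fun hv => ⟨Submodule.Quotient.mk ⟨v, (Submodule.Quotient.mk_eq_zero _).mp hv⟩, rfl⟩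
    · rintro ⟨w, hw⟩
      obtain ⟨w, rfl⟩ := Submodule.Quotient.mk_surjective _ w
      rw [← hw]
      exact (Submodule.Quotient.mk_eq_zero _).mpr w.2

end QRep

theorem linearMap_eq_sum_coord_smulRight {K V W ι : Type*} [Field K] [AddCommGroup V]
    [AddCommGroup W] [Module K V] [Module K W] [Fintype ι] (b : Module.Basis ι K V)
    (f : V →ₗ[K] W) : f = ∑ m, (b.coord m).smulRight (f (b m)) := by
  classical
  exact b.ext fun m => by simp [LinearMap.sum_apply, Finsupp.single_apply]

namespace QRep

variable {Q : Type} [Quiver.{0} Q]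

/-! ### The Auslander-Reiten formula -/

open scoped Classical in
/-- The arrow family with a single possibly nonzero entry, at the arrow `a`. -/
noncomputable def single {A B : QRep Q} {i j : Q} (a : i ⟶ j) :
    (A.V i →ₗ[ℂ] B.V j) →ₗ[ℂ] ArrowFamily A B :=
  (LinearMap.single ℂ (fun i => ∀ (j : Q) (_ : i ⟶ j), A.V i →ₗ[ℂ] B.V j) i) ∘ₗ
    (LinearMap.single ℂ (fun j => ∀ (_ : i ⟶ j), A.V i →ₗ[ℂ] B.V j) j) ∘ₗ
    (LinearMap.single ℂ (fun _ : i ⟶ j => A.V i →ₗ[ℂ] B.V j) a)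

theorem ArrowFamily.hom_ext [Finite Q] [∀ i j : Q, Finite (i ⟶ j)] {A B : QRep Q} {W : Type*}
    [AddCommGroup W] [Module ℂ W] {f g : ArrowFamily A B →ₗ[ℂ] W}
    (h : ∀ {i j : Q} (a : i ⟶ j) (φ : A.V i →ₗ[ℂ] B.V j), f (single a φ) = g (single a φ)) :
    f = g := by
  classical
  refine LinearMap.pi_ext' fun i => LinearMap.pi_ext' fun j => LinearMap.pi_ext' fun a =>
    LinearMap.ext fun φ => ?_
  convert h a φ <;> simp [single]

theorem postcomp_single (A : QRep Q) {B C : QRep Q} (g : Hom B C) {i j : Q} (a : i ⟶ j)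
    (φ : A.V i →ₗ[ℂ] B.V j) : postcomp A g (single a φ) = single a (g.app j ∘ₗ φ) := by
  classical
  funext k l b
  simp only [single, postcomp_apply, LinearMap.comp_apply, LinearMap.coe_single]
  obtain rfl | hk := eq_or_ne k i
  · obtain rfl | hl := eq_or_ne l j
    · obtain rfl | hb := eq_or_ne b a
      · simp only [Pi.single_eq_same]
      · simp only [Pi.single_eq_same, Pi.single_eq_of_ne hb, LinearMap.comp_zero]
    · simp only [Pi.single_eq_same, Pi.single_eq_of_ne hl, Pi.zero_apply, LinearMap.comp_zero]
  · simp only [Pi.single_eq_of_ne hk, Pi.zero_apply, LinearMap.comp_zero]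

/-- The action of a path on a representation. -/
def pathMap (M : QRep Q) {i : Q} : ∀ {k : Q}, Quiver.Path i k → M.V i →ₗ[ℂ] M.V k
  | _, .nil => LinearMap.id
  | _, .cons p a => M.map a ∘ₗ pathMap M p

theorem pathMap_comp (M : QRep Q) {i j k : Q} (p : Quiver.Path i j) (q : Quiver.Path j k)
    (v : M.V i) : M.pathMap (p.comp q) v = M.pathMap q (M.pathMap p v) := by
  induction q with
  | nil => rfl
  | cons q a ih => exact congrArg (M.map a) ih

/-- The basis vector of `P(i)` given by a path. -/
noncomputable def pathVec {i k : Q} (p : Quiver.Path i k) : (P i).V k :=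
  (Finsupp.single p 1 : Quiver.Path i k →₀ ℂ)

theorem P_hom_ext {i k : Q} {W : Type*} [AddCommGroup W] [Module ℂ W] {f g : (P i).V k →ₗ[ℂ] W}
    (h : ∀ p : Quiver.Path i k, f (pathVec p) = g (pathVec p)) : f = g :=
  Finsupp.lhom_ext' fun p => LinearMap.ext_ring (h p)

theorem P_map_pathVec {i k l : Q} (a : k ⟶ l) (p : Quiver.Path i k) :
    (P i).map a (pathVec p) = pathVec (p.cons a) :=
  Finsupp.mapDomain_single

theorem PMap_pathVec {i j k : Q} (a : i ⟶ j) (p : Quiver.Path j k) :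
    (PMap a).app k (pathVec p) = pathVec (a.toPath.comp p) :=
  Finsupp.mapDomain_single

theorem linearCombination_pathVec {i k : Q} {W : Type*} [AddCommGroup W] [Module ℂ W]
    (w : Quiver.Path i k → W) (p : Quiver.Path i k) :
    Finsupp.linearCombination ℂ w (pathVec p) = w p :=
  (Finsupp.linearCombination_single ℂ 1 p).trans (one_smul ℂ _)

/-- The homomorphism `P(i) ⟶ M` sending the trivial path to `v`. -/
noncomputable def fromP (M : QRep Q) {i : Q} (v : M.V i) : Hom (P i) M where
  app k := Finsupp.linearCombination ℂ fun p : Quiver.Path i k => M.pathMap p v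
  comm {k l} a := P_hom_ext fun p => by
    have h := linearCombination_pathVec (fun p : Quiver.Path i l => M.pathMap p v) (p.cons a)
    rw [← P_map_pathVec] at h
    exact (congrArg (M.map a) (linearCombination_pathVec _ p)).trans h.symm

theorem fromP_pathVec (M : QRep Q) {i : Q} (v : M.V i) {k : Q} (p : Quiver.Path i k) :
    (M.fromP v).app k (pathVec p) = M.pathMap p v :=
  linearCombination_pathVec _ p

theorem fromP_add (M : QRep Q) {i : Q} (v w : M.V i) (k : Q) :
    (M.fromP (v + w)).app k = (M.fromP v).app k + (M.fromP w).app k :=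
  P_hom_ext fun p => by simp only [LinearMap.add_apply, fromP_pathVec, map_add]

theorem fromP_smul (M : QRep Q) {i : Q} (c : ℂ) (v : M.V i) (k : Q) :
    (M.fromP (c • v)).app k = c • (M.fromP v).app k :=
  P_hom_ext fun p => by simp only [LinearMap.smul_apply, fromP_pathVec, map_smul]

theorem fromP_comp_PMap (M : QRep Q) {i j : Q} (a : i ⟶ j) (v : M.V i) (k : Q) :
    (M.fromP v).app k ∘ₗ (PMap a).app k = (M.fromP (M.map a v)).app k :=
  P_hom_ext fun p => by
    rw [LinearMap.comp_apply, PMap_pathVec, fromP_pathVec, fromP_pathVec, pathMap_comp]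
    rfl

theorem extMap_eq_of_app_eq_add {X A B : QRep Q} {f g h : Hom A B}
    (hf : ∀ k, f.app k = g.app k + h.app k) : extMap X f = extMap X g + extMap X h := by
  refine Submodule.linearMap_qext _ (LinearMap.ext fun θ => congrArg Submodule.Quotient.mk ?_)
  exact ArrowFamily.ext fun a v => by simp [hf]

theorem extMap_eq_of_app_eq_smul {X A B : QRep Q} {f g : Hom A B} {c : ℂ}
    (hf : ∀ k, f.app k = c • g.app k) : extMap X f = c • extMap X g := by
  refine Submodule.linearMap_qext _ (LinearMap.ext fun θ => congrArg Submodule.Quotient.mk ?_)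
  exact ArrowFamily.ext fun a v => by simp [hf]

theorem extMap_eq_of_app_eq_comp {X A B C : QRep Q} {f : Hom A C} {g : Hom B C} {h : Hom A B}
    (hf : ∀ k, g.app k ∘ₗ h.app k = f.app k) : extMap X g ∘ₗ extMap X h = extMap X f := by
  refine Submodule.linearMap_qext _ (LinearMap.ext fun θ => congrArg Submodule.Quotient.mk ?_)
  exact ArrowFamily.ext fun {i j} a v => LinearMap.congr_fun (hf j) (θ i j a v)

/-- The homomorphism `Y ⟶ τ X` defined by a linear form on `Ext(X, Y)`. -/
noncomputable def homTau {X Y : QRep Q} (l : Module.Dual ℂ (Ext X Y)) : Hom Y (tau X) where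
  app i :=
    { toFun := fun y => l ∘ₗ extMap X (Y.fromP y)
      map_add' := fun y z => by
        rw [extMap_eq_of_app_eq_add (fromP_add Y y z), LinearMap.comp_add]
        rfl
      map_smul' := fun c y => by
        rw [extMap_eq_of_app_eq_smul (fromP_smul Y c y), LinearMap.comp_smul]
        rfl }
  comm a := LinearMap.ext fun y =>
    congrArg (l ∘ₗ ·) (extMap_eq_of_app_eq_comp (fromP_comp_PMap Y a y))

theorem subsingleton_ext_of_homVanishes_tau [Finite Q] [∀ i j : Q, Finite (i ⟶ j)] {X Y : QRep Q}
    (hX : ∀ i, Module.Finite ℂ (X.V i)) (h : HomVanishes Y (tau X)) : Subsingleton (Ext X Y) := by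
  rw [← Module.subsingleton_dual_iff (K := ℂ)]
  refine subsingleton_of_forall_eq 0 fun l => Submodule.linearMap_qext _ ?_
  have hrankOne : ∀ {i j : Q} (a : i ⟶ j) (ξ : Module.Dual ℂ (X.V i)) (y : Y.V j),
      l (Submodule.Quotient.mk (single a (ξ.smulRight y))) = 0 := by
    intro i j a ξ y
    have hy : (Y.fromP y).app j ∘ₗ
        ξ.smulRight (pathVec (Quiver.Path.nil : Quiver.Path j j)) = ξ.smulRight y :=
      LinearMap.ext fun v => by
        rw [LinearMap.comp_apply, LinearMap.smulRight_apply, map_smul, fromP_pathVec]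
        rfl
    rw [← hy, ← postcomp_single]
    exact LinearMap.congr_fun (LinearMap.congr_fun (h (homTau l) j) y) (Submodule.Quotient.mk _)
  refine ArrowFamily.hom_ext fun {i j} a φ => ?_
  have := hX i
  rw [linearMap_eq_sum_coord_smulRight (Module.finBasis ℂ (X.V i)) φ]
  simp only [map_sum]
  exact Finset.sum_congr rfl fun m _ => hrankOne a _ _

/-! ### Extensions of representations -/

/-- The extension of `A` by `B` given by an arrow family. -/
def extension {A B : QRep Q} (η : ArrowFamily A B) : QRep Q where
  V i := B.V i × A.V i
  map {i j} a := ((B.map a).coprod (η i j a)).prod (A.map a ∘ₗ LinearMap.snd ℂ _ _)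

theorem extension_map_apply {A B : QRep Q} (η : ArrowFamily A B) {i j : Q} (a : i ⟶ j)
    (v : B.V i × A.V i) :
    (extension η).map a v = (B.map a v.1 + η i j a v.2, A.map a v.2) := rfl

/-- The projection of an extension. -/
def extensionSnd {A B : QRep Q} (η : ArrowFamily A B) : Hom (extension η) A where
  app i := LinearMap.snd ℂ (B.V i) (A.V i)
  comm _ := rfl

/-- The inclusion into an extension. -/
def extensionInl {A B : QRep Q} (η : ArrowFamily A B) : Hom B (extension η) where
  app i := LinearMap.inl ℂ (B.V i) (A.V i)
  comm {i j} a := LinearMap.ext fun v => Prod.ext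
    ((congrArg (B.map a v + ·) (map_zero (η i j a))).trans (add_zero _)) (map_zero (A.map a))

theorem IsProjective.subsingleton_ext {A : QRep Q} (hA : A.IsProjective) (B : QRep Q) :
    Subsingleton (Ext A B) := by
  refine subsingleton_ext_iff.mpr fun η => ?_
  obtain ⟨l, hl⟩ := hA _ A (extensionSnd η) (Hom.id A) fun i => LinearMap.snd_surjective
  have hl_snd : ∀ i v, (l.app i v : B.V i × A.V i).2 = v := fun i v =>
    LinearMap.congr_fun (hl i) v
  refine ⟨fun i => LinearMap.fst ℂ (B.V i) (A.V i) ∘ₗ l.app i, ArrowFamily.ext fun a v => ?_⟩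
  have hfst := congrArg Prod.fst
    ((extension_map_apply η a (l.app _ v)).symm.trans (l.comm_apply a v))
  rw [hl_snd] at hfst
  exact sub_eq_of_eq_add' hfst.symm

theorem IsInjective.subsingleton_ext {B : QRep Q} (hB : B.IsInjective) (A : QRep Q) :
    Subsingleton (Ext A B) := by
  refine subsingleton_ext_iff.mpr fun η => ?_
  obtain ⟨l, hl⟩ := hB B _ (extensionInl η) (Hom.id B) fun i => LinearMap.inl_injective
  have hl_inl : ∀ i v, l.app i ((v, 0) : B.V i × A.V i) = v := fun i v =>
    LinearMap.congr_fun (hl i) v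
  let s : ∀ i, A.V i →ₗ[ℂ] B.V i := fun i => l.app i ∘ₗ LinearMap.inr ℂ (B.V i) (A.V i)
  refine ⟨-s, ArrowFamily.ext fun {i j} a v => ?_⟩
  have hmap : (extension η).map a ((0, v) : B.V i × A.V i) =
      ((η i j a v, 0) + (0, A.map a v) : B.V j × A.V j) :=
    Prod.ext ((congrArg (· + _) (map_zero (B.map a))).trans (add_comm _ _)) (zero_add _).symm
  have hs : B.map a (s i v) = η i j a v + s j (A.map a v) := by
    refine (l.comm_apply a ((0, v) : B.V i × A.V i)).trans ?_
    rw [hmap]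
    exact (map_add (l.app j) _ _).trans (congrArg (· + _) (hl_inl _ _))
  rw [ringel_apply, Pi.neg_apply, Pi.neg_apply, LinearMap.neg_apply, LinearMap.neg_apply, map_neg,
    hs]
  abel

end QRep

namespace QRep

variable {Q : Type} [Quiver.{0} Q] {M : QRep Q} {U : ∀ i, Submodule ℂ (M.V i)}

/-! ### Orthogonal splittings -/

/-- All the vector spaces of the representation are finite-dimensional. -/
def IsFinite (M : QRep Q) : Prop := ∀ i, Module.Finite ℂ (M.V i)

/-- The endomorphism `e` is the projection to `A` for a decomposition `M = A ⊕ B` with `A` and `B`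
nonzero, `Ext(A, B) = 0` and `Hom(B, A) = 0`. -/
structure IsOrthogonalProjection (e : Hom M M) : Prop where
  idem : ∀ i v, e.app i (e.app i v) = e.app i v
  ne_zero : ∃ i, e.app i ≠ 0
  ne_id : ∃ i, e.app i ≠ LinearMap.id
  ext : ∀ η : ArrowFamily M M, ∃ ψ : ∀ i, M.V i →ₗ[ℂ] M.V i, ∀ (i j : Q) (a : i ⟶ j),
    ringel M M ψ i j a = (LinearMap.id - e.app j) ∘ₗ η i j a ∘ₗ e.app i
  hom : ∀ (ψ : Hom M M) (i : Q), e.app i ∘ₗ ψ.app i ∘ₗ (LinearMap.id - e.app i) = 0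

/-- `M = A ⊕ B` with `A` and `B` nonzero, `Ext(A, B) = 0` and `Hom(B, A) = 0`. -/
def HasOrthogonalSplitting (M : QRep Q) : Prop :=
  ∃ e : Hom M M, IsOrthogonalProjection e

theorem quotProj_eq_zero_iff (hU : M.IsStable U) {i : Q} {v : M.V i} :
    (quotProj hU).app i v = 0 ↔ v ∈ U i :=
  Submodule.Quotient.mk_eq_zero _

theorem exists_subIncl_comp_eq (hU : M.IsStable U) {W : Type*} [AddCommGroup W] [Module ℂ W] {i : Q}
    {f : W →ₗ[ℂ] M.V i} (hf : ∀ w, (quotProj hU).app i (f w) = 0) :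
    ∃ f' : W →ₗ[ℂ] (sub hU).V i, ∀ w, (subIncl hU).app i (f' w) = f w :=
  ⟨f.codRestrict (U i) fun w => (quotProj_eq_zero_iff hU).mp (hf w), fun _ => rfl⟩

theorem exists_section_of_subsingleton_ext (hU : M.IsStable U)
    (hExt : Subsingleton (Ext (quot hU) (sub hU))) :
    ∃ t : Hom (quot hU) M, ∀ i v, (quotProj hU).app i (t.app i v) = v := by
  let ι := subIncl hU
  let q := quotProj hU
  choose s hs using fun i => (q.app i).exists_rightInverse_of_surjective (U i).range_mkQ
  have hqs : ∀ i v, q.app i (s i v) = v := fun i v => LinearMap.congr_fun (hs i) v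
  have hqι : ∀ i v, q.app i (ι.app i v) = 0 := fun i v => (quotProj_eq_zero_iff hU).mpr v.2
  -- The failure of the linear sections `s i` to commute with the arrows is a cocycle.
  choose η hη using fun i j a => exists_subIncl_comp_eq hU
    (f := M.map a ∘ₗ s i - s j ∘ₗ (quot hU).map a) fun v => by
      change q.app j (M.map a (s i v) - s j ((quot hU).map a v)) = 0
      rw [map_sub, hqs, ← q.comm_apply, hqs, sub_self]
  obtain ⟨ψ, hψ⟩ := subsingleton_ext_iff.mp hExt η
  refine ⟨⟨fun i => s i + ι.app i ∘ₗ ψ i, fun {i j} a => LinearMap.ext fun v => ?_⟩,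
    fun i v => ?_⟩
  · have h : ι.app j (ψ j ((quot hU).map a v)) - M.map a (ι.app i (ψ i v)) =
        M.map a (s i v) - s j ((quot hU).map a v) := by
      rw [ι.comm_apply, ← map_sub, ← ringel_apply, hψ]
      exact hη i j a v
    simp only [LinearMap.comp_apply, LinearMap.add_apply, map_add]
    rw [sub_eq_sub_iff_add_eq_add.mp h.symm, add_comm]
  · change q.app i (s i v + ι.app i (ψ i v)) = v
    rw [map_add, hqs, hqι, add_zero]

theorem hasOrthogonalSplitting_of_sub (hU : M.IsStable U) (hbot : ∃ i, U i ≠ ⊥)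
    (htop : ∃ i, U i ≠ ⊤) (hExt : Subsingleton (Ext (quot hU) (sub hU)))
    (hHom : HomVanishes (sub hU) (quot hU)) : M.HasOrthogonalSplitting := by
  let ι := subIncl hU
  let q := quotProj hU
  obtain ⟨t, ht⟩ : ∃ t : Hom (quot hU) M, ∀ i v, q.app i (t.app i v) = v :=
    exists_section_of_subsingleton_ext hU hExt
  have hqt : ∀ i v, q.app i (v - t.app i (q.app i v)) = 0 := fun i v => by
    rw [map_sub, ht, sub_self]
  refine ⟨t.comp q, fun i v => congrArg (t.app i) (ht i _), ?_, ?_, fun η => ?_,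
    fun ψ i => LinearMap.ext fun v => ?_⟩
  · obtain ⟨i, hi⟩ := htop
    refine ⟨i, fun h => hi (eq_top_iff.mpr fun v _ => (quotProj_eq_zero_iff hU).mp ?_)⟩
    have htq : t.app i (q.app i v) = 0 := LinearMap.congr_fun h v
    rw [← ht i ((quotProj hU).app i v), htq, map_zero]
  · obtain ⟨i, hi⟩ := hbot
    refine ⟨i, fun h => hi (eq_bot_iff.mpr fun v hv => ?_)⟩
    have htq : t.app i (q.app i v) = v := LinearMap.congr_fun h v
    rw [(quotProj_eq_zero_iff hU).mpr hv, map_zero] at htq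
    exact htq.symm
  · choose η' hη' using fun i j a => exists_subIncl_comp_eq hU
      (f := (LinearMap.id - t.app j ∘ₗ q.app j) ∘ₗ η i j a ∘ₗ t.app i) fun _ => hqt j _
    obtain ⟨ψ, hψ⟩ := subsingleton_ext_iff.mp hExt η'
    refine ⟨fun i => ι.app i ∘ₗ ψ i ∘ₗ q.app i, fun i j a => LinearMap.ext fun v => ?_⟩
    have h := hη' i j a (q.app i v)
    rw [← hψ, ringel_apply, map_sub, ← Hom.comm_apply] at h
    exact h
  · have h : q.app i (ψ.app i (v - t.app i (q.app i v))) = 0 :=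
      LinearMap.congr_fun (hHom (q.comp (ψ.comp ι)) i)
        ⟨_, (quotProj_eq_zero_iff hU).mp (hqt i v)⟩
    exact (congrArg (t.app i) h).trans (map_zero _)

/-! ### The torsion pair of an iterated translate -/

theorem IsTorsionFreeClass.exists_homVanishes_sub [Finite Q] {F : QRep Q → Prop}
    (hF : IsTorsionFreeClass F) (hM : M.IsFinite) :
    ∃ (U : ∀ i, Submodule ℂ (M.V i)) (hU : M.IsStable U),
      F (quot hU) ∧ ∀ Z, F Z → HomVanishes (sub hU) Z := by
  have (i : Q) : Module.Finite ℂ (M.V i) := hM i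
  let S : Set (∀ i, Submodule ℂ (M.V i)) := {U | ∃ hU : M.IsStable U, F (quot hU)}
  have hS : S.Nonempty := ⟨⊤, fun _ _ _ _ _ => trivial,
    hF.of_isZero fun _ => Submodule.Quotient.subsingleton_iff.mpr rfl⟩
  obtain ⟨U, ⟨hU, hFU⟩, hmin⟩ := exists_minimal_of_wellFoundedLT (· ∈ S) hS
  refine ⟨U, hU, hFU, fun Z hZ f i => LinearMap.ext fun v => ?_⟩
  have hker : kerIn f ∈ S := ⟨isStable_kerIn f,
    hF.of_leftExact (leftExact_quot_kerIn f) (hF.of_injective f.descend_injective hZ) hFU⟩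
  exact mem_kerIn_iff.mp (hmin hker (kerIn_le f) i v.2)

theorem subsingleton_ext_or_hasOrthogonalSplitting [Finite Q] [∀ i j : Q, Finite (i ⟶ j)]
    (hM : M.IsFinite) (h : ∃ (k : ℕ) (Z : QRep Q), (tau^[k] Z).IsZero ∧ ¬ HomVanishes M Z) :
    Subsingleton (Ext M M) ∨ M.HasOrthogonalSplitting := by
  classical
  obtain ⟨k, ⟨Z₀, hZ₀, hMZ₀⟩, hmin⟩ : ∃ k, (∃ Z : QRep Q, (tau^[k] Z).IsZero ∧ ¬ HomVanishes M Z) ∧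
      ∀ m < k, ∀ Z : QRep Q, (tau^[m] Z).IsZero → HomVanishes M Z :=
    ⟨Nat.find h, Nat.find_spec h, fun m hm Z hZ => by_contra fun hMZ =>
      Nat.find_min h hm ⟨Z, hZ, hMZ⟩⟩
  obtain _ | m := k
  · refine absurd (fun (f : Hom M Z₀) i => LinearMap.ext fun v => ?_) hMZ₀
    have : Subsingleton (Z₀.V i) := hZ₀ i
    exact Subsingleton.elim _ _
  have hF : IsTorsionFreeClass fun A : QRep Q => (tau^[m + 1] A).IsZero :=
    isTorsionFreeClass_iterate_tau (m + 1)
  obtain ⟨U, hU, hquot, hsub⟩ := hF.exists_homVanishes_sub hM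
  by_cases hbot : ∃ i, U i ≠ ⊥
  · refine Or.inr (hasOrthogonalSplitting_of_sub hU hbot ?_
      (subsingleton_ext_of_homVanishes_tau ?_ (hsub _ ?_)) (hsub _ hquot))
    · by_contra! htop
      refine hMZ₀ fun f i => LinearMap.ext fun v => ?_
      exact LinearMap.congr_fun (hsub Z₀ hZ₀ (f.comp (subIncl hU)) i) ⟨v, htop i ▸ trivial⟩
    · exact fun i => have := hM i; inferInstanceAs (Module.Finite ℂ (M.V i ⧸ U i))
    · rw [Function.iterate_succ_apply', ← Function.iterate_succ_apply]
      exact hquot.tau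
  · push Not at hbot
    have hinj : ∀ i, Function.Injective ((quotProj hU).app i) := fun i =>
      LinearMap.ker_eq_bot.mp ((Submodule.ker_mkQ _).trans (hbot i))
    exact Or.inl (subsingleton_ext_of_homVanishes_tau hM
      (hmin m (Nat.lt_succ_self m) _ (hF.of_injective hinj hquot)))

end QRep

theorem linearMap_dualMap_injective {K V W : Type*} [Field K] [AddCommGroup V] [AddCommGroup W]
    [Module K V] [Module K W] :
    Function.Injective (LinearMap.dualMap : (V →ₗ[K] W) → Module.Dual K W →ₗ[K] Module.Dual K V) :=
  fun f g h => LinearMap.ext fun v => sub_eq_zero.mp <|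
    (Module.forall_dual_apply_eq_zero_iff K _).mp fun l => by
      rw [map_sub, sub_eq_zero]
      exact LinearMap.congr_fun (LinearMap.congr_fun h l) v

theorem linearMap_dualMap_surjective {K V W : Type*} [Field K] [AddCommGroup V] [AddCommGroup W]
    [Module K V] [Module K W] [Module.Finite K W] :
    Function.Surjective
      (LinearMap.dualMap : (V →ₗ[K] W) → Module.Dual K W →ₗ[K] Module.Dual K V) := fun f =>
  ⟨(Module.evalEquiv K W).symm.toLinearMap ∘ₗ f.flip, LinearMap.ext fun l => LinearMap.ext fun v =>
    Module.apply_evalEquiv_symm_apply K W l (f.flip v)⟩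

namespace QRep

variable {Q : Type} [Quiver.{0} Q] {M N : QRep Q}

open Opposite

/-! ### Duality -/

theorem IsFinite.dual (hM : M.IsFinite) : M.dual.IsFinite := fun i =>
  have := hM i.unop
  inferInstanceAs (Module.Finite ℂ (Module.Dual ℂ (M.V i.unop)))

theorem isZero_of_isZero_dual (h : M.dual.IsZero) : M.IsZero := fun i =>
  (Module.subsingleton_dual_iff ℂ).mp (h (op i))

theorem dual_iterate_tauInv (M : QRep Q) (k : ℕ) : dual (tauInv^[k] M) = tau^[k] (dual M) := by
  induction k generalizing M with
  | zero => rfl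
  | succ _ ih => exact ih (tauInv M)

theorem Hom.ext_app {f g : Hom M N} (h : ∀ i, f.app i = g.app i) : f = g := by
  cases f
  cases g
  congr
  exact funext h

/-- The transposed homomorphism. -/
def Hom.dual (f : Hom M N) : Hom (dual N) (dual M) where
  app i := (f.app i.unop).dualMap
  comm {i _} a := LinearMap.ext fun (l : Module.Dual ℂ (N.V i.unop)) => LinearMap.ext fun v =>
    congrArg l (f.comm_apply a.unop v).symm

theorem Hom.exists_dual_app_eq (hN : N.IsFinite) (f : Hom N.dual M.dual) :
    ∃ g : Hom M N, ∀ i, (g.dual).app i = f.app i := by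
  have (i : Q) : Module.Finite ℂ (N.V i) := hN i
  choose g hg using fun i : Q => linearMap_dualMap_surjective (f.app (op i))
  refine ⟨⟨g, fun {i j} a => linearMap_dualMap_injective ?_⟩, fun i => hg i.unop⟩
  change (g i).dualMap ∘ₗ (N.map a).dualMap = (M.map a).dualMap ∘ₗ (g j).dualMap
  rw [hg, hg]
  exact (f.comm a.op).symm

theorem ringel_dual_dualMap (ψ : ∀ i, M.V i →ₗ[ℂ] N.V i) {i j : Q} (a : i ⟶ j) :
    ringel N.dual M.dual (fun k => (ψ k.unop).dualMap) (op j) (op i) a.op =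
      (ringel M N (-ψ) i j a).dualMap := by
  refine LinearMap.ext fun (l : Module.Dual ℂ (N.V j)) => LinearMap.ext fun v => ?_
  change l (N.map a (ψ i v)) - l (ψ j (M.map a v)) =
    l (-ψ j (M.map a v) - N.map a (-ψ i v))
  rw [map_neg, ← map_sub, sub_neg_eq_add, neg_add_eq_sub]

theorem subsingleton_ext_dual_iff (hN : N.IsFinite) :
    Subsingleton (Ext N.dual M.dual) ↔ Subsingleton (Ext M N) := by
  have (i : Q) : Module.Finite ℂ (N.V i) := hN i
  rw [subsingleton_ext_iff, subsingleton_ext_iff]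
  refine ⟨fun h η => ?_, fun h η => ?_⟩
  · obtain ⟨Ψ, hΨ⟩ := h fun (i j : Qᵒᵖ) a => (η j.unop i.unop a.unop).dualMap
    choose ψ hψ using fun i => linearMap_dualMap_surjective (Ψ (op i))
    obtain rfl : (fun k : Qᵒᵖ => (ψ k.unop).dualMap) = Ψ := funext fun i => hψ i.unop
    refine ⟨-ψ, funext fun i => funext fun j => funext fun a => linearMap_dualMap_injective ?_⟩
    exact (ringel_dual_dualMap ψ a).symm.trans
      (congrFun (congrFun (congrFun hΨ (op j)) (op i)) a.op)
  · choose η' hη' using fun i j a =>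
      linearMap_dualMap_surjective (η (op j) (op i) (Quiver.Hom.op a))
    obtain ⟨ψ, hψ⟩ := h η'
    refine ⟨fun k => (-ψ k.unop).dualMap, funext fun i => funext fun j => funext fun a => ?_⟩
    refine (ringel_dual_dualMap (fun k => -ψ k) a.unop).trans ?_
    have hη : ringel M N ψ _ _ a.unop = η' _ _ a.unop :=
      congrFun (congrFun (congrFun hψ _) _) _
    rw [show -(fun k => -ψ k) = ψ from neg_neg ψ, hη]
    exact hη' j.unop i.unop a.unop

theorem extMap_surjective (X : QRep Q) {f : Hom M N} (hf : ∀ i, Function.Surjective (f.app i)) :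
    Function.Surjective (extMap X f) := by
  intro e
  obtain ⟨θ, rfl⟩ := Submodule.Quotient.mk_surjective _ e
  choose s hs using fun i =>
    (f.app i).exists_rightInverse_of_surjective (LinearMap.range_eq_top.mpr (hf i))
  refine ⟨Submodule.Quotient.mk fun i j a => s j ∘ₗ θ i j a, congrArg Submodule.Quotient.mk ?_⟩
  exact ArrowFamily.ext fun {i j} a v => LinearMap.congr_fun (hs j) (θ i j a v)

theorem IsFinite.exists_surjective_dual {Y : QRep Qᵒᵖ} (hY : Y.IsFinite) :
    ∃ (A : QRep Q) (f : Hom A.dual Y), ∀ i, Function.Surjective (f.app i) := by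
  have (i : Qᵒᵖ) : Module.Finite ℂ (Y.V i) := hY i
  let A : QRep Q :=
    { V := fun i => Module.Dual ℂ (Y.V (op i))
      map := fun a => (Y.map a.op).dualMap }
  let ε : ∀ i, Y.V i ≃ₗ[ℂ] Module.Dual ℂ (Module.Dual ℂ (Y.V i)) := fun i =>
    Module.evalEquiv ℂ (Y.V i)
  refine ⟨A, ⟨fun i => (ε i).symm.toLinearMap, fun {i j} a => LinearMap.ext fun v => ?_⟩,
    fun i => (ε i).symm.surjective⟩
  obtain ⟨y, rfl⟩ := (ε i).surjective v
  refine (congrArg (Y.map a) ((ε i).symm_apply_apply y)).trans ?_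
  exact ((ε j).symm_apply_apply (Y.map a y)).symm

theorem IsInjective.isZero_tau_dual (hP : ∀ i : Qᵒᵖ, (P i).IsFinite) (hM : M.IsFinite)
    (h : M.IsInjective) : (tau M.dual).IsZero := isZero_tau fun i => by
  obtain ⟨A, f, hf⟩ := (hP i).exists_surjective_dual
  have := (subsingleton_ext_dual_iff hM).mpr (h.subsingleton_ext A)
  exact (extMap_surjective M.dual hf).subsingleton

/-- The endomorphism `1 - f`. -/
def Hom.oneSub (f : Hom M M) : Hom M M where
  app i := LinearMap.id - f.app i
  comm a := LinearMap.ext fun v => by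
    simp only [LinearMap.comp_apply, LinearMap.sub_apply, LinearMap.id_apply, map_sub,
      f.comm_apply]

theorem IsOrthogonalProjection.of_dual (hM : M.IsFinite) {f : Hom M M}
    (h : IsOrthogonalProjection f.dual) : IsOrthogonalProjection f.oneSub where
  idem i v := by
    have hf : f.app i ∘ₗ f.app i = f.app i := linearMap_dualMap_injective <|
      LinearMap.ext fun l => h.idem (op i) l
    have hfv : f.app i (f.app i v) = f.app i v := LinearMap.congr_fun hf v
    simp only [Hom.oneSub, LinearMap.sub_apply, LinearMap.id_apply, map_sub, hfv, sub_self,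
      sub_zero]
  ne_zero := by
    obtain ⟨i, hi⟩ := h.ne_id
    refine ⟨i.unop, fun hf => hi ?_⟩
    exact (congrArg LinearMap.dualMap (sub_eq_zero.mp hf).symm).trans LinearMap.dualMap_id
  ne_id := by
    obtain ⟨i, hi⟩ := h.ne_zero
    exact ⟨i.unop, fun hf => hi <| (congrArg LinearMap.dualMap (sub_eq_self.mp hf)).trans <|
      LinearMap.ext fun (l : Module.Dual ℂ (M.V i.unop)) => LinearMap.ext fun _ => map_zero l⟩
  ext η := by
    have (i : Q) : Module.Finite ℂ (M.V i) := hM i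
    obtain ⟨Ψ, hΨ⟩ := h.ext fun (i j : Qᵒᵖ) a => (η j.unop i.unop a.unop).dualMap
    choose ψ hψ using fun i => linearMap_dualMap_surjective (Ψ (op i))
    obtain rfl : (fun k : Qᵒᵖ => (ψ k.unop).dualMap) = Ψ := funext fun i => hψ i.unop
    refine ⟨-ψ, fun i j a => linearMap_dualMap_injective ?_⟩
    rw [← ringel_dual_dualMap, hΨ]
    refine LinearMap.ext fun (l : Module.Dual ℂ (M.V j)) => LinearMap.ext fun v => ?_
    change l (f.app j (η i j a v)) - l (f.app j (η i j a (f.app i v))) =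
      l (η i j a (v - f.app i v) - (η i j a (v - f.app i v) - f.app j (η i j a (v - f.app i v))))
    rw [sub_sub_cancel, map_sub, map_sub, map_sub]
  hom ψ i := by
    refine linearMap_dualMap_injective ((Eq.trans ?_ (h.hom ψ.dual (op i))).trans ?_)
    · refine LinearMap.ext fun (l : Module.Dual ℂ (M.V i)) => LinearMap.ext fun v => ?_
      change l (ψ.app i (v - (v - f.app i v)) - f.app i (ψ.app i (v - (v - f.app i v)))) =
        l (ψ.app i (f.app i v)) - l (f.app i (ψ.app i (f.app i v)))
      rw [sub_sub_cancel, map_sub]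
    · exact LinearMap.ext fun (l : Module.Dual ℂ (M.V i)) =>
        LinearMap.ext fun _ => (map_zero l).symm

theorem HasOrthogonalSplitting.of_dual (hM : M.IsFinite)
    (h : M.dual.HasOrthogonalSplitting) : M.HasOrthogonalSplitting := by
  obtain ⟨e, he⟩ := h
  obtain ⟨f, hf⟩ := Hom.exists_dual_app_eq hM e
  obtain rfl : f.dual = e := Hom.ext_app hf
  exact ⟨f.oneSub, he.of_dual hM⟩

/-! ### Representations that are not regular -/

theorem not_homVanishes_of_surjective {f : Hom M N} (hf : ∀ i, Function.Surjective (f.app i))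
    (hN : ¬ N.IsZero) : ¬ HomVanishes M N := fun h => hN fun i =>
  subsingleton_of_forall_eq 0 fun v => by
    obtain ⟨w, rfl⟩ := hf i v
    exact LinearMap.congr_fun (h f i) w

theorem IsSummand.exists_retraction (h : IsSummand N M) :
    ∃ (s : Hom N M) (p : Hom M N), ∀ i v, p.app i (s.app i v) = v := by
  obtain ⟨N', φ, hφ⟩ := h
  let E : ∀ i, M.V i ≃ₗ[ℂ] N.V i × N'.V i := fun i => LinearEquiv.ofBijective (φ.app i) (hφ i)
  have hE : ∀ {i j : Q} (a : i ⟶ j) v, E j (M.map a v) = (N.sum N').map a (E i v) :=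
    fun a v => (φ.comm_apply a v).symm
  refine ⟨⟨fun i => (E i).symm.toLinearMap ∘ₗ LinearMap.inl ℂ _ _, fun {i j} a =>
    LinearMap.ext fun v => (E j).injective ?_⟩,
    Hom.comp (B := N.sum N') ⟨fun i => LinearMap.fst ℂ (N.V i) (N'.V i), fun _ => rfl⟩ φ,
    fun i v => congrArg Prod.fst ((E i).apply_symm_apply (v, 0))⟩
  change E j (M.map a ((E i).symm (v, 0))) = E j ((E j).symm (N.map a v, 0))
  rw [hE, LinearEquiv.apply_symm_apply, LinearEquiv.apply_symm_apply]
  exact Prod.ext rfl (map_zero (N'.map a))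

theorem IsFinite.iterate_tauInv [Finite Q] [∀ i j : Q, Finite (i ⟶ j)]
    (hP : ∀ i : Qᵒᵖ, (P i).IsFinite) (hM : M.IsFinite) (k : ℕ) : (tauInv^[k] M).IsFinite := by
  refine Function.Iterate.rec _ hM (fun A hA i => ?_) k
  have : Finite Qᵒᵖ := Finite.of_equiv _ Opposite.equivToOpposite
  have (i j : Qᵒᵖ) : Finite (i ⟶ j) :=
    Finite.of_equiv (j.unop ⟶ i.unop) (Quiver.Hom.opEquiv (X := j.unop) (Y := i.unop))
  have (k l : Qᵒᵖ) : Module.Finite ℂ (A.dual.V k →ₗ[ℂ] (P (op i)).V l) := by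
    have := hA.dual k
    have := hP (op i) l
    infer_instance
  exact inferInstanceAs (Module.Finite ℂ (Ext A.dual (P (op i))))

theorem subsingleton_ext_or_hasOrthogonalSplitting_of_not_isRegular [Finite Q]
    [∀ i j : Q, Finite (i ⟶ j)] (hP : ∀ i : Qᵒᵖ, (P i).IsFinite) (hM : M.IsFinite)
    (h : ¬ M.IsRegular) : Subsingleton (Ext M M) ∨ M.HasOrthogonalSplitting := by
  obtain ⟨N, hN, hpre⟩ : ∃ N : QRep Q, IsSummand N M ∧ (N.IsPreprojective ∨ N.IsPreinjective) := by
    unfold IsRegular at h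
    push Not at h
    obtain ⟨N, -, hN, hpre⟩ := h
    exact ⟨N, hN, or_iff_not_imp_left.mpr hpre⟩
  obtain ⟨s, p, hps⟩ := hN.exists_retraction
  obtain ⟨k, hk₀, hk⟩ | ⟨k, hk₀, hk⟩ := hpre
  · refine subsingleton_ext_or_hasOrthogonalSplitting hM ⟨k + 1, N, ?_,
      not_homVanishes_of_surjective (f := p) (fun i v => ⟨_, hps i v⟩)
        fun hN₀ => hk₀ ((isTorsionFreeClass_iterate_tau k).of_isZero hN₀)⟩
    rw [Function.iterate_succ_apply']
    exact isZero_tau fun i => hk.subsingleton_ext _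
  · have hs : ∀ i, Function.Injective (s.app i) := fun i => Function.LeftInverse.injective (hps i)
    have hNfin : N.IsFinite := fun i =>
      have := hM i
      Module.Finite.of_injective (s.app i) (hs i)
    have : Finite Qᵒᵖ := Finite.of_equiv _ Opposite.equivToOpposite
    have (i j : Qᵒᵖ) : Finite (i ⟶ j) :=
      Finite.of_equiv (j.unop ⟶ i.unop) (Quiver.Hom.opEquiv (X := j.unop) (Y := i.unop))
    refine (subsingleton_ext_or_hasOrthogonalSplitting hM.dual ⟨k + 1, N.dual, ?_,
      not_homVanishes_of_surjective (f := s.dual)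
        (fun i => LinearMap.dualMap_surjective_of_injective (hs i.unop)) fun hN₀ =>
          hk₀ (isZero_of_isZero_dual ?_)⟩).imp (subsingleton_ext_dual_iff hM).mp (.of_dual hM)
    · rw [Function.iterate_succ_apply', ← dual_iterate_tauInv]
      exact hk.isZero_tau_dual hP (hNfin.iterate_tauInv hP k)
    · rw [dual_iterate_tauInv]
      exact (isTorsionFreeClass_iterate_tau k).of_isZero hN₀

end QRep

/-! ### Quivers with a dense orbit -/

section Quiver

variable {V : Type*} [Quiver V]

theorem finite_setOf_path_length_le [Finite V] [∀ i j : V, Finite (i ⟶ j)] (a b : V) (n : ℕ) :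
    {p : Quiver.Path a b | p.length ≤ n}.Finite := by
  have hzero (b : V) : {p : Quiver.Path a b | p.length = 0}.Finite := by
    refine Set.Subsingleton.finite ?_
    rintro (_ | ⟨p, e⟩) hp (_ | ⟨q, e'⟩) hq
    · rfl
    all_goals simp_all
  induction n generalizing b with
  | zero => simpa only [Nat.le_zero] using hzero b
  | succ n ih =>
    refine ((hzero b).union (Set.finite_iUnion fun c => Set.finite_iUnion fun e : c ⟶ b =>
      (ih c).image fun p => p.cons e)).subset ?_
    rintro (_ | ⟨p, e⟩) hp
    · exact Or.inl rfl
    · exact Or.inr (Set.mem_iUnion₂.mpr ⟨_, e, p, Nat.le_of_succ_le_succ hp, rfl⟩)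

theorem nodup_path_vertices_of_acyclic (hV : ∀ (a : V) (p : Quiver.Path a a), p.length = 0)
    {a b : V} (p : Quiver.Path a b) : p.vertices.Nodup := by
  induction p with
  | nil => exact List.nodup_singleton a
  | @cons b c p e ih =>
    rw [Quiver.Path.vertices_cons, List.concat_eq_append, List.nodup_append]
    refine ⟨ih, List.nodup_singleton c, ?_⟩
    rintro v hv w hw rfl
    rw [List.mem_singleton] at hw
    subst hw
    obtain ⟨-, p₂, -⟩ := p.exists_eq_comp_of_mem_vertices hv
    exact Nat.succ_ne_zero _ (hV _ (p₂.cons e))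

theorem finite_path_of_acyclic [Finite V] [∀ i j : V, Finite (i ⟶ j)]
    (hV : ∀ (a : V) (p : Quiver.Path a a), p.length = 0) (a b : V) : Finite (Quiver.Path a b) := by
  have := Fintype.ofFinite V
  refine Set.finite_univ_iff.mp
    ((finite_setOf_path_length_le a b (Fintype.card V)).subset fun p _ => ?_)
  have hcard := (nodup_path_vertices_of_acyclic hV p).length_le_card
  rw [p.vertices_length] at hcard
  exact (Nat.le_succ _).trans hcard

theorem exists_path_unop_length_eq {a b : Vᵒᵖ} (p : Quiver.Path a b) :
    ∃ q : Quiver.Path b.unop a.unop, q.length = p.length := by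
  induction p with
  | nil => exact ⟨.nil, rfl⟩
  | cons p e ih =>
    obtain ⟨q, hq⟩ := ih
    exact ⟨e.unop.toPath.comp q, by
      rw [Quiver.Path.length_comp, Quiver.Path.length_toPath, hq, add_comm]; rfl⟩

end Quiver

theorem QRep.isFinite_P_op {Q : Type} [Quiver.{0} Q] [Finite Q] [∀ i j : Q, Finite (i ⟶ j)]
    (hQ : ∀ (a : Q) (p : Quiver.Path a a), p.length = 0) (i : Qᵒᵖ) : (P i).IsFinite := by
  intro k
  have : Finite Qᵒᵖ := Finite.of_equiv _ Opposite.equivToOpposite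
  have (i j : Qᵒᵖ) : Finite (i ⟶ j) :=
    Finite.of_equiv (j.unop ⟶ i.unop) (Quiver.Hom.opEquiv (X := j.unop) (Y := i.unop))
  have : Finite (Quiver.Path i k) := finite_path_of_acyclic (fun a p => by
    obtain ⟨q, hq⟩ := exists_path_unop_length_eq p
    rw [← hq, hQ]) i k
  exact inferInstanceAs (Module.Finite ℂ (Quiver.Path i k →₀ ℂ))

theorem dense_setOf_eval_ne_zero {𝕜 ι : Type*} [RCLike 𝕜] [Finite ι] {f : MvPolynomial ι 𝕜}
    (hf : f ≠ 0) : Dense {x : ι → 𝕜 | MvPolynomial.eval x f ≠ 0} := by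
  have := Fintype.ofFinite ι
  change Dense {x : ι → 𝕜 | MvPolynomial.eval x f = 0}ᶜ
  rw [← interior_eq_empty_iff_dense_compl, Set.eq_empty_iff_forall_notMem]
  refine fun x hx => hf (MvPolynomial.funext fun y => ?_)
  have hzero := (AnalyticOnNhd.eval_mvPolynomial f).eq_of_eventuallyEq (z₀ := x)
    (analyticOnNhd_const (v := 0)) (mem_interior_iff_mem_nhds.mp hx)
  rw [map_zero]
  exact congrFun hzero y

theorem IsHypersurface.isClosed {ι : Type} {D : Set (ι → ℂ)} (hD : IsHypersurface D) :
    IsClosed D := by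
  obtain ⟨f, -, rfl⟩ := hD
  exact isClosed_eq (MvPolynomial.continuous_eval f) continuous_const

theorem IsHypersurface.dense_compl {ι : Type} [Finite ι] {D : Set (ι → ℂ)}
    (hD : IsHypersurface D) : Dense Dᶜ := by
  obtain ⟨f, hf, rfl⟩ := hD
  exact dense_setOf_eval_ne_zero hf

namespace RepSpace

variable {Q : Type} [Quiver.{0} Q] {d : Q → ℕ}

/-- The matrix of a path in the representation `x`: the product of the matrices of its arrows. -/
def pathMat (x : RepSpace Q d) {i : Q} : ∀ {k : Q}, Quiver.Path i k →
    Matrix (Fin (d k)) (Fin (d i)) ℂ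
  | _, .nil => 1
  | _, .cons p a => mat x a * pathMat x p

theorem mat_act (g : ∀ i, GL (Fin (d i)) ℂ) (x : RepSpace Q d) {i j : Q} (a : i ⟶ j) :
    mat (act g x) a = (g j).1 * mat x a * ((g i)⁻¹).1 := rfl

theorem pathMat_act (g : ∀ i, GL (Fin (d i)) ℂ) (x : RepSpace Q d) {i k : Q}
    (p : Quiver.Path i k) : pathMat (act g x) p = (g k).1 * pathMat x p * ((g i)⁻¹).1 := by
  induction p with
  | nil => simp only [pathMat, mul_one, Units.mul_inv]
  | cons p a ih =>
    simp only [pathMat, ih, mat_act, Matrix.mul_assoc]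
    rw [← Matrix.mul_assoc (g _)⁻¹.1, Units.inv_mul, Matrix.one_mul]

theorem trace_pathMat_act (g : ∀ i, GL (Fin (d i)) ℂ) (x : RepSpace Q d) {i : Q}
    (p : Quiver.Path i i) : (pathMat (act g x) p).trace = (pathMat x p).trace := by
  rw [pathMat_act, Matrix.trace_units_conj]

theorem continuous_pathMat {i k : Q} (p : Quiver.Path i k) :
    Continuous fun x : RepSpace Q d => pathMat x p := by
  induction p with
  | nil => exact continuous_const
  | cons p a ih =>
    exact (continuous_matrix fun _ _ => continuous_apply _ : Continuous fun x => mat x a).matrix_mul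
      ih

theorem pathMat_zero {i k : Q} (p : Quiver.Path i k) (hp : p.length ≠ 0) :
    pathMat (0 : RepSpace Q d) p = 0 := by
  cases p with
  | nil => exact absurd rfl hp
  | cons p a => exact Matrix.zero_mul _

theorem exists_pathMat_eq_single (hd : ∀ i, 1 ≤ d i) : ∃ (y : RepSpace Q d) (z : ∀ i, Fin (d i)),
    ∀ {i k : Q} (p : Quiver.Path i k), p.length ≠ 0 →
      pathMat y p = Matrix.single (z k) (z i) 1 := by
  let z : ∀ i, Fin (d i) := fun i => ⟨0, hd i⟩
  let y : RepSpace Q d := fun c => Matrix.single (z c.2.1) (z c.1) (1 : ℂ) c.2.2.2.1 c.2.2.2.2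
  refine ⟨y, z, fun {i k} p hp => ?_⟩
  have hy : ∀ {k l : Q} (a : k ⟶ l), mat y a = Matrix.single (z l) (z k) 1 := fun _ => rfl
  induction p with
  | nil => exact absurd rfl hp
  | cons p a ih =>
    rcases p with _ | ⟨p, b⟩
    · exact Matrix.mul_one _
    · rw [pathMat, ih (Nat.succ_ne_zero _), hy, Matrix.single_mul_single_same, mul_one]

/-- The trace along an oriented cycle is an invariant of the action, hence constant if some orbit
is dense; but it takes the values `0` and `1`. -/
theorem length_eq_zero_of_dense_orbit (hd : ∀ i, 1 ≤ d i) {x₀ : RepSpace Q d}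
    (h : Dense (Set.range fun g => act g x₀)) (i : Q) (p : Quiver.Path i i) : p.length = 0 := by
  by_contra hp
  have htrace : (fun x : RepSpace Q d => (pathMat x p).trace) = fun _ => (pathMat x₀ p).trace := by
    refine (continuous_pathMat p).matrix_trace.ext_on h continuous_const ?_
    rintro _ ⟨g, rfl⟩
    exact trace_pathMat_act g x₀ p
  obtain ⟨y, z, hy⟩ := exists_pathMat_eq_single (Q := Q) hd
  have hyzero := (congrFun htrace y).trans (congrFun htrace 0).symm
  rw [hy p hp, pathMat_zero p hp, Matrix.trace_single_eq_same, Matrix.trace_zero] at hyzero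
  exact one_ne_zero hyzero

theorem isFinite_toQRep (x : RepSpace Q d) : (toQRep x).IsFinite := fun i =>
  inferInstanceAs (Module.Finite ℂ (Fin (d i) → ℂ))

theorem subsingleton_ext_or_hasOrthogonalSplitting [Finite Q] [∀ i j : Q, Finite (i ⟶ j)]
    (hd : ∀ i, 1 ≤ d i) {x₀ : RepSpace Q d} (h : Dense (Set.range fun g => act g x₀))
    {x : RepSpace Q d} (hx : ¬ x.toQRep.IsRegular) :
    Subsingleton (QRep.Ext x.toQRep x.toQRep) ∨ x.toQRep.HasOrthogonalSplitting :=
  QRep.subsingleton_ext_or_hasOrthogonalSplitting_of_not_isRegular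
    (QRep.isFinite_P_op (length_eq_zero_of_dense_orbit hd h)) (isFinite_toQRep x) hx

end RepSpace

/-! ### Derivations of determinants and polynomials -/

section Derivation

variable {R A ι : Type*} [CommSemiring R]

theorem derivation_finset_prod [CommSemiring A] [Algebra R A] [DecidableEq ι]
    (δ : Derivation R A A) (s : Finset ι) (g : ι → A) :
    δ (∏ i ∈ s, g i) = ∑ i ∈ s, ∏ j ∈ s, Function.update g i (δ (g i)) j := by
  induction s using Finset.induction_on with
  | empty => simp only [Finset.prod_empty, Derivation.map_one_eq_zero, Finset.sum_empty]
  | insert a s ha ih =>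
    rw [Finset.prod_insert ha, δ.leibniz, ih, Finset.sum_insert ha, smul_eq_mul, smul_eq_mul,
      add_comm, Finset.prod_insert ha, Function.update_self, Finset.mul_sum, mul_comm]
    congr 1
    · congr 1
      refine Finset.prod_congr rfl fun j hj => ?_
      rw [Function.update_of_ne (ne_of_mem_of_not_mem hj ha)]
    · refine Finset.sum_congr rfl fun i hi => ?_
      rw [Finset.prod_insert ha, Function.update_of_ne (ne_of_mem_of_not_mem hi ha).symm]

theorem derivation_finset_sum_apply [CommSemiring A] [Algebra R A] (s : Finset ι)
    (δ : ι → Derivation R A A) (f : A) : (∑ i ∈ s, δ i) f = ∑ i ∈ s, δ i f := by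
  change Derivation.coeFnAddMonoidHom (∑ i ∈ s, δ i) f = _
  rw [map_sum, Finset.sum_apply]
  rfl

variable [Fintype ι]

theorem derivation_det [DecidableEq ι] [CommRing A] [Algebra R A] (δ : Derivation R A A)
    (B : Matrix ι ι A) : δ B.det = (B.adjugate * B.map δ).trace := by
  have hcol : δ B.det = ∑ i, (B.updateCol i fun k => δ (B k i)).det := by
    simp only [Matrix.det_apply, map_sum, Derivation.map_smul_of_tower]
    rw [Finset.sum_comm]
    refine Finset.sum_congr rfl fun σ _ => ?_
    rw [← Finset.smul_sum, derivation_finset_prod]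
    congr 1
    refine Finset.sum_congr rfl fun i _ => Finset.prod_congr rfl fun j _ => ?_
    obtain rfl | hj := eq_or_ne j i
    · rw [Function.update_self, Matrix.updateCol_self]
    · rw [Function.update_of_ne hj, Matrix.updateCol_ne hj]
  rw [hcol, Matrix.trace]
  refine Finset.sum_congr rfl fun i _ => ?_
  rw [← Matrix.cramer_apply, Matrix.cramer_eq_adjugate_mulVec]
  rfl

theorem derivation_det_eq_trace_mul [DecidableEq ι] [CommRing A] [Algebra R A]
    (δ : Derivation R A A) {B M N : Matrix ι ι A} (h : B.map δ = M * B + B * N) :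
    δ B.det = (M.trace + N.trace) * B.det := by
  rw [derivation_det, h, Matrix.mul_add, Matrix.trace_add, ← Matrix.mul_assoc,
    Matrix.trace_mul_comm, ← Matrix.mul_assoc, ← Matrix.mul_assoc, Matrix.mul_adjugate,
    Matrix.adjugate_mul, Matrix.smul_mul, Matrix.smul_mul, Matrix.one_mul, Matrix.one_mul,
    Matrix.trace_smul, Matrix.trace_smul, smul_eq_mul, smul_eq_mul]
  ring

end Derivation

section Polynomial

open MvPolynomial

variable {K ι : Type*} [Field K]

theorem derivation_eq_sum_mul_pderiv [Fintype ι]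
    (δ : Derivation K (MvPolynomial ι K) (MvPolynomial ι K)) (f : MvPolynomial ι K) :
    δ f = ∑ l, δ (X l) * pderiv l f := by
  classical
  have hδ : δ = ∑ l, δ (X l) • pderiv l := derivation_ext fun i => by
    simp only [derivation_finset_sum_apply, Derivation.smul_apply, pderiv_X, smul_eq_mul,
      Pi.single_apply, mul_ite, mul_one, mul_zero, Finset.sum_ite_eq, Finset.mem_univ, if_true]
  conv_lhs => rw [hδ]
  rw [derivation_finset_sum_apply]
  rfl

theorem totalDegree_pderiv_lt {p : MvPolynomial ι K} {i : ι} (h : pderiv i p ≠ 0) :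
    (pderiv i p).totalDegree < p.totalDegree := by
  obtain ⟨m, hm, hdeg⟩ := Finset.exists_mem_eq_sup (pderiv i p).support
    (Finset.nonempty_iff_ne_empty.mpr (by simpa using h)) (fun s => s.sum fun _ e => e)
  have hmem : m + Finsupp.single i 1 ∈ p.support := by
    rw [mem_support_iff] at hm ⊢
    rw [coeff_pderiv] at hm
    exact left_ne_zero_of_mul hm
  have hle := le_totalDegree hmem
  rw [Finsupp.sum_add_index' (fun _ => rfl) (fun _ _ _ => rfl), Finsupp.sum_single_index rfl] at hle
  change (pderiv i p).totalDegree = m.sum fun _ e => e at hdeg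
  omega

theorem eq_C_of_forall_pderiv_eq_zero [CharZero K] {p : MvPolynomial ι K}
    (h : ∀ i, pderiv i p = 0) : p = C (coeff 0 p) := by
  classical
  ext m
  rw [coeff_C]
  split_ifs with hm
  · rw [hm]
  · obtain ⟨i, hi⟩ := Finsupp.ne_iff.mp (Ne.symm hm)
    have hcoeff := coeff_pderiv (i := i) p (m - Finsupp.single i 1)
    rw [h, tsub_add_cancel_of_le (Finsupp.single_le_iff.mpr (Nat.one_le_iff_ne_zero.mpr hi)),
      coeff_zero, eq_comm, mul_eq_zero] at hcoeff
    exact hcoeff.resolve_right (Nat.cast_add_one_ne_zero _)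

theorem exists_not_dvd_pderiv_of_irreducible [CharZero K] {p : MvPolynomial ι K}
    (hp : Irreducible p) : ∃ i, ¬ p ∣ pderiv i p := by
  by_contra! hdvd
  have hC := eq_C_of_forall_pderiv_eq_zero (p := p) fun i => by
    by_contra hne
    obtain ⟨q, hq⟩ := hdvd i
    have hlt := totalDegree_pderiv_lt hne
    rw [hq, totalDegree_mul_of_isDomain hp.ne_zero (right_ne_zero_of_mul (hq ▸ hne))] at hlt
    exact absurd hlt (Nat.not_lt.mpr (Nat.le_add_right _ _))
  rw [hC] at hp
  exact hp.not_isUnit ((isUnit_iff_ne_zero.mpr fun h => hp.ne_zero (by rw [h, C_0])).map C)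

theorem exists_not_dvd_pderiv_of_squarefree [CharZero K] {p f : MvPolynomial ι K}
    (hp : Irreducible p) (hf : Squarefree f) (hpf : p ∣ f) : ∃ i, ¬ p ∣ pderiv i f := by
  obtain ⟨q, rfl⟩ := hpf
  obtain ⟨i, hi⟩ := exists_not_dvd_pderiv_of_irreducible hp
  refine ⟨i, fun h => ?_⟩
  rw [pderiv_mul, dvd_add_left (dvd_mul_right p _)] at h
  refine (hp.prime.dvd_or_dvd h).elim hi fun hq => ?_
  exact hp.not_isUnit (hf p (mul_dvd_mul_left p hq))

theorem dvd_of_squarefree_of_forall_irreducible {R : Type*} [CommMonoidWithZero R] [Nontrivial R]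
    [UniqueFactorizationMonoid R] {f g : R} (hf : Squarefree f)
    (h : ∀ p, Irreducible p → p ∣ f → p ∣ g) : f ∣ g := by
  induction f using WfDvdMonoid.induction_on_irreducible generalizing g with
  | zero => exact absurd rfl hf.ne_zero
  | unit u hu => exact hu.dvd
  | mul a p _ hp ih =>
    obtain ⟨c, rfl⟩ := ih hf.of_mul_right fun q hq hqa => h q hq (hqa.mul_left p)
    rcases hp.prime.dvd_or_dvd (h p hp (dvd_mul_right p a)) with hpa | hpc
    · exact absurd (hf p (mul_dvd_mul_left p hpa)) hp.not_isUnit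
    · rw [mul_comm p a]
      exact mul_dvd_mul_left a hpc

theorem hasDerivAt_eval_comp {ι : Type*} (δ : Derivation ℂ (MvPolynomial ι ℂ) (MvPolynomial ι ℂ))
    {γ : ℂ → ι → ℂ} {t : ℂ}
    (h : ∀ j, HasDerivAt (fun s => γ s j) (eval (γ t) (δ (X j))) t) (p : MvPolynomial ι ℂ) :
    HasDerivAt (fun s => eval (γ s) p) (eval (γ t) (δ p)) t := by
  induction p using MvPolynomial.induction_on with
  | C a => simpa using hasDerivAt_const t a
  | add p q hp hq =>
    simp only [map_add]
    exact hp.add hq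
  | mul_X p j hp =>
    simp only [map_mul, eval_X, Derivation.leibniz, smul_eq_mul, map_add]
    exact (hp.mul (h j)).congr_deriv (by ring)

end Polynomial

/-! ### Saito's criterion -/

theorem det_eq_pow_mul_of_diagonal_off {R ι : Type*} [CommRing R] [Fintype ι] [DecidableEq ι]
    {M : Matrix ι ι R} {i : ι} {c : R} (hrow : ∀ l, l ≠ i → M i l = 0)
    (hoff : ∀ k l, k ≠ i → l ≠ i → M k l = if k = l then c else 0) :
    M.det = c ^ Fintype.card {k // k ≠ i} * M i i := by
  have hdiag : M.toSquareBlockProp (fun k => k ≠ i) = Matrix.diagonal fun _ => c := by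
    ext ⟨k, hk⟩ ⟨l, hl⟩ : 1
    simp only [Matrix.toSquareBlockProp_def, Matrix.of_apply, hoff k l hk hl,
      Matrix.diagonal_apply, Subtype.mk.injEq]
  let _ : Unique {k // ¬ k ≠ i} := ⟨⟨i, not_not.mpr rfl⟩, fun k => Subtype.ext (not_not.mp k.2)⟩
  rw [Matrix.twoBlockTriangular_det M (fun k => k ≠ i), hdiag, Matrix.det_diagonal,
    Finset.prod_const, Finset.card_univ, Matrix.det_unique (n := {k // ¬ k ≠ i})]
  · rfl
  · exact fun k hk l hl => not_not.mp hk ▸ hrow l hl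

section LinearFreeDivisor

open MvPolynomial

variable {ι : Type}

/-- The coefficient matrix `(δ_k(x_j))_{k,j}` of a family of vector fields `δ_k`, whose determinant
is the Saito determinant of the family. -/
noncomputable def coeffMatrix (δ : ι → Derivation ℂ (MvPolynomial ι ℂ) (MvPolynomial ι ℂ)) :
    Matrix ι ι (MvPolynomial ι ℂ) :=
  Matrix.of fun k j => δ k (X j)

theorem det_coeffMatrix_dvd [Fintype ι] [DecidableEq ι] {D : Set (ι → ℂ)}
    (b : Module.Basis ι (MvPolynomial ι ℂ) (logDer D))
    {θ : ι → Derivation ℂ (MvPolynomial ι ℂ) (MvPolynomial ι ℂ)} (hθ : ∀ k, θ k ∈ logDer D) :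
    (coeffMatrix fun k => (b k).1).det ∣ (coeffMatrix θ).det := by
  have hmul : coeffMatrix θ = Matrix.of (fun k l => b.repr ⟨θ k, hθ k⟩ l) *
      coeffMatrix fun k => (b k).1 := by
    ext k j : 1
    have hrepr : θ k = ∑ l, b.repr ⟨θ k, hθ k⟩ l • (b l).1 :=
      (congrArg Subtype.val (b.sum_repr ⟨θ k, hθ k⟩)).symm.trans
        (map_sum (logDer D).subtype _ _)
    rw [Matrix.mul_apply]
    refine (DFunLike.congr_fun hrepr (X j)).trans ?_
    rw [derivation_finset_sum_apply]
    rfl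
  rw [hmul, Matrix.det_mul]
  exact dvd_mul_left _ _

/-- `f` is a reduced equation of `D`: a squarefree polynomial generating the ideal of `D` and
having `D` as its zero set. -/
structure IsReducedEquation (D : Set (ι → ℂ)) (f : MvPolynomial ι ℂ) : Prop where
  ideal_eq : idealOf D = Ideal.span {f}
  squarefree : Squarefree f
  mem_iff : ∀ x, x ∈ D ↔ eval x f = 0

theorem IsHypersurface.exists_isReducedEquation [Finite ι] {D : Set (ι → ℂ)}
    (hD : IsHypersurface D) : ∃ f, IsReducedEquation D f := by
  obtain ⟨g, hg, rfl⟩ := hD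
  let _ : StrongNormalizationMonoid (MvPolynomial ι ℂ) :=
    UniqueFactorizationMonoid.strongNormalizationMonoid
  have hideal : idealOf {x | eval x g = 0} = Ideal.span {UniqueFactorizationMonoid.radical g} := by
    have hlocus : {x : ι → ℂ | eval x g = 0} = zeroLocus ℂ (Ideal.span {g}) := by
      ext x
      simp [zeroLocus_span]
    rw [idealOf, hlocus, vanishingIdeal_zeroLocus_eq_radical]
    ext p
    rw [Ideal.mem_span_singleton, ← UniqueFactorizationMonoid.exists_dvd_pow_iff_radical_dvd hg]
    simp only [Ideal.mem_radical_iff, Ideal.mem_span_singleton]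
  refine ⟨UniqueFactorizationMonoid.radical g, hideal, UniqueFactorizationMonoid.squarefree_radical,
    fun x => ⟨fun hx => ?_, fun hx => ?_⟩⟩
  · have hmem : UniqueFactorizationMonoid.radical g ∈ idealOf {x | eval x g = 0} :=
      hideal ▸ Ideal.mem_span_singleton_self _
    simpa using hmem x hx
  · obtain ⟨c, hc⟩ := UniqueFactorizationMonoid.radical_dvd_self (a := g)
    change eval x g = 0
    rw [hc, map_mul, hx, zero_mul]

namespace IsReducedEquation

variable {D : Set (ι → ℂ)} {f : MvPolynomial ι ℂ}

theorem mem_idealOf_iff (hf : IsReducedEquation D f) {g : MvPolynomial ι ℂ} :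
    g ∈ idealOf D ↔ f ∣ g := by
  rw [hf.ideal_eq, Ideal.mem_span_singleton]

theorem mem_logDer_iff (hf : IsReducedEquation D f)
    {δ : Derivation ℂ (MvPolynomial ι ℂ) (MvPolynomial ι ℂ)} : δ ∈ logDer D ↔ f ∣ δ f := by
  refine ⟨fun h => hf.mem_idealOf_iff.mp (h f (hf.mem_idealOf_iff.mpr dvd_rfl)), fun h g hg => ?_⟩
  obtain ⟨c, rfl⟩ := hf.mem_idealOf_iff.mp hg
  rw [hf.mem_idealOf_iff, δ.leibniz]
  exact dvd_add (dvd_mul_right f _) (h.mul_left c)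

theorem smul_mem_logDer (hf : IsReducedEquation D f)
    (δ : Derivation ℂ (MvPolynomial ι ℂ) (MvPolynomial ι ℂ)) : f • δ ∈ logDer D :=
  hf.mem_logDer_iff.mpr (dvd_mul_right f _)

variable [Fintype ι] [DecidableEq ι]

theorem dvd_det_coeffMatrix (hf : IsReducedEquation D f)
    {δ : ι → Derivation ℂ (MvPolynomial ι ℂ) (MvPolynomial ι ℂ)} (hδ : ∀ k, δ k ∈ logDer D) :
    f ∣ (coeffMatrix δ).det := by
  have hcramer (j : ι) : ∑ k, (coeffMatrix δ).adjugate j k * δ k f =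
      pderiv j f * (coeffMatrix δ).det := by
    have hmulVec (k : ι) : δ k f = (coeffMatrix δ).mulVec (fun l => pderiv l f) k :=
      derivation_eq_sum_mul_pderiv (δ k) f
    simp only [hmulVec]
    change (coeffMatrix δ).adjugate.mulVec ((coeffMatrix δ).mulVec fun l => pderiv l f) j = _
    rw [Matrix.mulVec_mulVec, Matrix.adjugate_mul, Matrix.smul_mulVec, Matrix.one_mulVec,
      Pi.smul_apply, smul_eq_mul, mul_comm]
  have hdvd (j : ι) : f ∣ pderiv j f * (coeffMatrix δ).det := by
    rw [← hcramer]
    exact Finset.dvd_sum fun k _ => (hf.mem_logDer_iff.mp (hδ k)).mul_left _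
  refine dvd_of_squarefree_of_forall_irreducible hf.squarefree fun p hp hpf => ?_
  obtain ⟨j, hj⟩ := exists_not_dvd_pderiv_of_squarefree hp hf.squarefree hpf
  exact (hp.prime.dvd_or_dvd (hpf.trans (hdvd j))).resolve_left hj

theorem exists_logDer_det_eq_pow_mul (hf : IsReducedEquation D f) (i : ι) :
    ∃ θ : ι → Derivation ℂ (MvPolynomial ι ℂ) (MvPolynomial ι ℂ), (∀ k, θ k ∈ logDer D) ∧
      ∃ m : ℕ, (coeffMatrix θ).det = pderiv i f ^ m * f := by
  refine ⟨fun k => if k = i then f • pderiv i else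
    pderiv i f • pderiv k - pderiv k f • pderiv i, fun k => ?_, Fintype.card {k // k ≠ i}, ?_⟩
  · dsimp only
    split_ifs with hk
    · exact hf.smul_mem_logDer _
    · rw [hf.mem_logDer_iff]
      simp [mul_comm]
  · rw [det_eq_pow_mul_of_diagonal_off (i := i) (c := pderiv i f)]
    · simp [coeffMatrix]
    · intro l hl
      simp [coeffMatrix, pderiv_X, hl]
    · intro k l hk hl
      simp [coeffMatrix, pderiv_X, hk, hl, Pi.single_apply, eq_comm (a := l)]

theorem associated_det_coeffMatrix (hf : IsReducedEquation D f)
    (b : Module.Basis ι (MvPolynomial ι ℂ) (logDer D)) :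
    Associated f (coeffMatrix fun k => (b k).1).det := by
  obtain ⟨q, hq⟩ := hf.dvd_det_coeffMatrix fun k => (b k).2
  have hf₀ := hf.squarefree.ne_zero
  have hdvd_pow : f * q ∣ f ^ Fintype.card ι := by
    have hdiag : coeffMatrix (fun k => f • pderiv k) = Matrix.diagonal fun _ : ι => f := by
      ext k l : 1
      simp [coeffMatrix, Matrix.diagonal_apply, pderiv_X, Pi.single_apply, eq_comm]
    have hdvd := det_coeffMatrix_dvd b (θ := fun k => f • pderiv k) fun _ => hf.smul_mem_logDer _
    rwa [hdiag, Matrix.det_diagonal, Finset.prod_const, Finset.card_univ, hq] at hdvd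
  have hdvd_pderiv_pow (i : ι) : ∃ m : ℕ, q ∣ pderiv i f ^ m := by
    obtain ⟨θ, hθ, m, hm⟩ := hf.exists_logDer_det_eq_pow_mul i
    have hdvd := det_coeffMatrix_dvd b hθ
    rw [hm, hq, mul_comm] at hdvd
    exact ⟨m, (mul_dvd_mul_iff_right hf₀).mp hdvd⟩
  have hunit : IsUnit q := by
    by_contra hq_unit
    have hq₀ : q ≠ 0 := right_ne_zero_of_mul (ne_zero_of_dvd_ne_zero (pow_ne_zero _ hf₀) hdvd_pow)
    obtain ⟨p, hp, hpq⟩ := WfDvdMonoid.exists_irreducible_factor hq_unit hq₀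
    obtain ⟨i, hi⟩ := exists_not_dvd_pderiv_of_squarefree hp hf.squarefree
      (hp.prime.dvd_of_dvd_pow ((hpq.mul_left f).trans hdvd_pow))
    obtain ⟨m, hm⟩ := hdvd_pderiv_pow i
    exact hi (hp.prime.dvd_of_dvd_pow (hpq.trans hm))
  exact hq ▸ associated_mul_unit_right f q hunit

end IsReducedEquation

end LinearFreeDivisor

/-! ### Linear vector fields -/

section LinearVectorField

open MvPolynomial Topology

variable {ι : Type} [Fintype ι] [DecidableEq ι]

theorem linearMap_apply_eq_sum_mul_single (l : (ι → ℂ) →ₗ[ℂ] ℂ) (x : ι → ℂ) :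
    l x = ∑ i, x i * l (Pi.single i 1) := by
  conv_lhs => rw [← Finset.univ_sum_single x, map_sum]
  refine Finset.sum_congr rfl fun i _ => ?_
  rw [← smul_eq_mul, ← map_smul, ← Pi.single_smul, smul_eq_mul, mul_one]

theorem linearMap_trace_eq_trace_toMatrix' (A : Module.End ℂ (ι → ℂ)) :
    LinearMap.trace ℂ _ A = (LinearMap.toMatrix' A).trace := by
  rw [LinearMap.trace_eq_matrix_trace ℂ (Pi.basisFun ℂ ι), LinearMap.toMatrix_eq_toMatrix']

/-- The homogeneous polynomial of degree one defined by a linear form. -/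
noncomputable def linForm : ((ι → ℂ) →ₗ[ℂ] ℂ) →ₗ[ℂ] MvPolynomial ι ℂ where
  toFun l := ∑ i, C (l (Pi.single i 1)) * X i
  map_add' l m := by simp [add_mul, Finset.sum_add_distrib]
  map_smul' c l := by simp [Finset.smul_sum, smul_eq_C_mul, mul_assoc]

theorem linForm_apply (l : (ι → ℂ) →ₗ[ℂ] ℂ) : linForm l = ∑ i, C (l (Pi.single i 1)) * X i := rfl

@[simp] theorem eval_linForm (l : (ι → ℂ) →ₗ[ℂ] ℂ) (x : ι → ℂ) : eval x (linForm l) = l x := by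
  rw [linearMap_apply_eq_sum_mul_single l x]
  simp [linForm_apply, mul_comm]

theorem pderiv_linForm (l : (ι → ℂ) →ₗ[ℂ] ℂ) (i : ι) :
    pderiv i (linForm l) = C (l (Pi.single i 1)) := by
  rw [linForm_apply, map_sum, Finset.sum_eq_single i]
  · rw [pderiv_C_mul, pderiv_X_self, mul_one]
  · intro j _ hj
    rw [pderiv_C_mul, pderiv_X_of_ne hj, mul_zero]
  · simp

theorem linForm_isHomogeneous (l : (ι → ℂ) →ₗ[ℂ] ℂ) : (linForm l).IsHomogeneous 1 :=
  IsHomogeneous.sum _ _ _ fun i _ => by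
    simpa using (isHomogeneous_C ι (l (Pi.single i 1))).mul (isHomogeneous_X ℂ i)

theorem exists_eq_linForm_of_isHomogeneous {p : MvPolynomial ι ℂ} (hp : p.IsHomogeneous 1) :
    ∃ l, p = linForm l := by
  refine ⟨∑ i, coeff 0 (pderiv i p) • LinearMap.proj i, ?_⟩
  have hconst (i : ι) : pderiv i p = C (coeff 0 (pderiv i p)) :=
    totalDegree_eq_zero_iff_eq_C.mp ((totalDegree_zero_iff_isHomogeneous _).mpr hp.pderiv)
  have heuler := hp.sum_X_mul_pderiv
  rw [one_smul] at heuler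
  conv_lhs => rw [← heuler]
  rw [linForm_apply]
  refine Finset.sum_congr rfl fun i _ => ?_
  rw [mul_comm]
  conv_lhs => rw [hconst]
  congr 2
  simp [LinearMap.sum_apply, Pi.single_apply]

/-- The vector field on `ι → ℂ` whose value at `x` is `L x`. -/
noncomputable def linVF : Module.End ℂ (ι → ℂ) →ₗ[ℂ]
    Derivation ℂ (MvPolynomial ι ℂ) (MvPolynomial ι ℂ) where
  toFun L := mkDerivation ℂ fun j => linForm (LinearMap.proj j ∘ₗ L)
  map_add' L L' := derivation_ext fun j => by
    simp [mkDerivation_X, LinearMap.comp_add]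
  map_smul' c L := derivation_ext fun j => by
    simp [mkDerivation_X, LinearMap.comp_smul]

theorem linVF_X (L : Module.End ℂ (ι → ℂ)) (j : ι) :
    linVF L (X j) = linForm (LinearMap.proj j ∘ₗ L) :=
  mkDerivation_X _ _ _

@[simp] theorem eval_linVF_X (L : Module.End ℂ (ι → ℂ)) (j : ι) (x : ι → ℂ) :
    eval x (linVF L (X j)) = L x j := by
  rw [linVF_X, eval_linForm]
  rfl

theorem linVF_linForm (L : Module.End ℂ (ι → ℂ)) (l : (ι → ℂ) →ₗ[ℂ] ℂ) :
    linVF L (linForm l) = linForm (l ∘ₗ L) := by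
  refine MvPolynomial.funext fun x => ?_
  rw [eval_linForm, linForm_apply, map_sum, map_sum, LinearMap.comp_apply,
    linearMap_apply_eq_sum_mul_single l (L x)]
  refine Finset.sum_congr rfl fun i _ => ?_
  rw [← smul_eq_C_mul, Derivation.map_smul, smul_eval, eval_linVF_X, mul_comm]

theorem IsLinearVectorField.exists_eq_linVF
    {δ : Derivation ℂ (MvPolynomial ι ℂ) (MvPolynomial ι ℂ)} (h : IsLinearVectorField δ) :
    ∃ L, δ = linVF L := by
  choose l hl using fun j => exists_eq_linForm_of_isHomogeneous (h j)
  refine ⟨LinearMap.pi l, derivation_ext fun j => ?_⟩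
  rw [hl, linVF_X, LinearMap.proj_pi]

theorem totalDegree_linVF_le (L : Module.End ℂ (ι → ℂ)) (p : MvPolynomial ι ℂ) :
    (linVF L p).totalDegree ≤ p.totalDegree := by
  rw [derivation_eq_sum_mul_pderiv]
  refine totalDegree_finsetSum_le fun l _ => ?_
  by_cases hne : pderiv l p = 0
  · simp [hne]
  · have hlt := totalDegree_pderiv_lt hne
    have hle : (linVF L (X l)).totalDegree ≤ 1 := by
      rw [linVF_X]
      exact (linForm_isHomogeneous _).totalDegree_le
    exact (totalDegree_mul _ _).trans (by omega)

theorem eq_sum_eval_zero_smul {A : Module.End ℂ (ι → ℂ)} {L : ι → Module.End ℂ (ι → ℂ)}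
    {q : ι → MvPolynomial ι ℂ} (h : linVF A = ∑ k, q k • linVF (L k)) :
    A = ∑ k, eval 0 (q k) • L k := by
  refine LinearMap.pi_ext' fun i => LinearMap.ext_ring (funext fun j => ?_)
  have hpderiv (k : ι) : eval 0 (pderiv i ((q k • linVF (L k)) (X j))) =
      eval 0 (q k) * L k (Pi.single i 1) j := by
    rw [Derivation.smul_apply, smul_eq_mul, linVF_X, pderiv_mul, pderiv_linForm, map_add, map_mul,
      map_mul, eval_linForm, map_zero, mul_zero, zero_add, eval_C]
    rfl
  have hA := congrArg (fun δ => eval 0 (pderiv i (δ (X j)))) h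
  simp only [derivation_finset_sum_apply, map_sum, hpderiv, linVF_X, pderiv_linForm, eval_C] at hA
  simpa [LinearMap.sum_apply] using hA

namespace IsReducedEquation

variable {D : Set (ι → ℂ)} {f : MvPolynomial ι ℂ}

theorem exists_linVF_eq_C_mul (hf : IsReducedEquation D f) {L : Module.End ℂ (ι → ℂ)}
    (hL : linVF L ∈ logDer D) : ∃ c : ℂ, linVF L f = C c * f := by
  obtain ⟨q, hq⟩ := hf.mem_logDer_iff.mp hL
  obtain rfl | hq₀ := eq_or_ne q 0
  · exact ⟨0, by rw [hq, mul_zero, C_0, zero_mul]⟩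
  · have hdeg := totalDegree_linVF_le L f
    rw [hq, totalDegree_mul_of_isDomain hf.squarefree.ne_zero hq₀] at hdeg
    refine ⟨coeff 0 q, ?_⟩
    rw [← totalDegree_eq_zero_iff_eq_C.mp (by omega : q.totalDegree = 0), hq, mul_comm]

theorem linVF_mem_logDer (hf : IsReducedEquation D f) {L : Module.End ℂ (ι → ℂ)}
    (h : ∀ x ∈ D, ∃ γ : ℂ → ι → ℂ, γ 0 = x ∧ (∀ᶠ s in 𝓝 0, γ s ∈ D) ∧
      HasDerivAt γ (L x) 0) :
    linVF L ∈ logDer D := by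
  rw [hf.mem_logDer_iff, ← hf.mem_idealOf_iff, mem_vanishingIdeal_iff]
  intro x hx
  obtain ⟨γ, rfl, hγ, hL⟩ := h x hx
  have hderiv := hasDerivAt_eval_comp (linVF L) (γ := γ)
    (fun j => by simpa only [eval_linVF_X] using hasDerivAt_pi.mp hL j) f
  have hvanish : (fun s => eval (γ s) f) =ᶠ[𝓝 0] fun _ => 0 :=
    hγ.mono fun s hs => (hf.mem_iff (γ s)).mp hs
  rw [aeval_eq_eval]
  exact hderiv.unique ((hasDerivAt_const 0 (0 : ℂ)).congr_of_eventuallyEq hvanish)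

theorem isUnit_map_eval_iff (hf : IsReducedEquation D f) {B : Matrix ι ι (MvPolynomial ι ℂ)}
    (hB : Associated f B.det) (y : ι → ℂ) : IsUnit (B.map (eval y)) ↔ y ∉ D := by
  obtain ⟨u, hu⟩ := hB
  have hdet : (B.map (eval y)).det = eval y f * eval y u := by
    rw [← map_mul, hu, RingHom.map_det]
    rfl
  have hu₀ : eval y (u : MvPolynomial ι ℂ) ≠ 0 := (u.isUnit.map (eval y)).ne_zero
  rw [Matrix.isUnit_iff_isUnit_det, hdet, isUnit_iff_ne_zero, hf.mem_iff]
  simp [hu₀]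

end IsReducedEquation

theorem vecMul_coeffMatrix_map_eval (A : (ι → ℂ) →ₗ[ℂ] Module.End ℂ (ι → ℂ)) (w y : ι → ℂ) :
    Matrix.vecMul w ((coeffMatrix fun k => linVF (A (Pi.single k 1))).map (eval y)) = A w y := by
  funext j
  have hsum := linearMap_apply_eq_sum_mul_single (LinearMap.proj j ∘ₗ A.flip y) w
  simpa [Matrix.vecMul, dotProduct, coeffMatrix] using hsum.symm

theorem map_linVF_coeffMatrix {A : (ι → ℂ) →ₗ[ℂ] Module.End ℂ (ι → ℂ)}
    {L n : Module.End ℂ (ι → ℂ)} (h : ∀ w, A (n w) = L * A w - A w * L) :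
    (coeffMatrix fun k => linVF (A (Pi.single k 1))).map (linVF L) =
      -((LinearMap.toMatrix' n).transpose.map C) * (coeffMatrix fun k => linVF (A (Pi.single k 1)))
        + (coeffMatrix fun k => linVF (A (Pi.single k 1))) *
          (LinearMap.toMatrix' L).transpose.map C := by
  ext k j : 1
  refine MvPolynomial.funext fun x => ?_
  have hleft : eval x (linVF L (coeffMatrix (fun k => linVF (A (Pi.single k 1))) k j)) =
      (A (Pi.single k 1) * L) x j := by
    change eval x (linVF L (linVF (A (Pi.single k 1)) (X j))) = _
    rw [linVF_X, linVF_linForm, eval_linForm]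
    rfl
  have hbracket := congrFun
    (vecMul_coeffMatrix_map_eval A ((LinearMap.toMatrix' n).transpose k) x) j
  have hrow : (LinearMap.toMatrix' n).transpose k = n (Pi.single k 1) := by
    funext m
    simp [LinearMap.toMatrix'_apply]
  have hmulVec (w : ι → ℂ) : L w j = ∑ i, w i * LinearMap.toMatrix' L j i := by
    rw [← LinearMap.toMatrix'_mulVec]
    simp [Matrix.mulVec, dotProduct, mul_comm]
  rw [Matrix.map_apply, hleft, ← sub_sub_cancel (L * A _) (A _ * L), ← h, LinearMap.sub_apply,
    Pi.sub_apply, ← hrow, ← hbracket, Module.End.mul_apply, hmulVec]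
  simp only [Matrix.add_apply, Matrix.mul_apply, map_add, map_sum, map_mul, Matrix.neg_apply,
    Matrix.map_apply, Matrix.transpose_apply, eval_C, Matrix.vecMul, dotProduct, map_neg,
    coeffMatrix, Matrix.of_apply, eval_linVF_X, neg_mul]
  ring

theorem linVF_det_coeffMatrix {A : (ι → ℂ) →ₗ[ℂ] Module.End ℂ (ι → ℂ)}
    {L n : Module.End ℂ (ι → ℂ)} (h : ∀ w, A (n w) = L * A w - A w * L) :
    linVF L (coeffMatrix fun k => linVF (A (Pi.single k 1))).det =
      C (LinearMap.trace ℂ _ L - LinearMap.trace ℂ _ n) *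
        (coeffMatrix fun k => linVF (A (Pi.single k 1))).det := by
  have htrace (A : Matrix ι ι ℂ) :
      (A.transpose.map (C : ℂ →+* MvPolynomial ι ℂ)).trace = C A.trace := by
    simp [Matrix.trace]
  rw [derivation_det_eq_trace_mul _ (map_linVF_coeffMatrix h), Matrix.trace_neg, htrace, htrace,
    linearMap_trace_eq_trace_toMatrix', linearMap_trace_eq_trace_toMatrix', map_sub,
    neg_add_eq_sub]

theorem derivation_eq_C_mul_of_associated {σ : Type*}
    {δ : Derivation ℂ (MvPolynomial σ ℂ) (MvPolynomial σ ℂ)} {f g : MvPolynomial σ ℂ}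
    (hfg : Associated f g) {c : ℂ} (hg : δ g = C c * g) : δ f = C c * f := by
  obtain ⟨u, rfl⟩ := hfg
  obtain ⟨a, -, ha⟩ := isUnit_iff_eq_C_of_isReduced.mp u.isUnit
  have hδ : δ (C a * f) = C a * δ f := by
    rw [← smul_eq_C_mul, Derivation.map_smul, smul_eq_C_mul]
  rw [ha, mul_comm f, hδ, mul_left_comm] at hg
  exact mul_left_cancel₀ (ha ▸ u.ne_zero) hg

variable {V : Type*} [AddCommGroup V] [Module ℂ V] {D : Set (ι → ℂ)}

theorem exists_forall_eq_linearCombination {b : Module.Basis ι (MvPolynomial ι ℂ) (logDer D)}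
    {L : ι → Module.End ℂ (ι → ℂ)} (hL : ∀ k, (b k).1 = linVF (L k))
    {ρ : V →ₗ[ℂ] Module.End ℂ (ι → ℂ)} (hlog : ∀ v, linVF (ρ v) ∈ logDer D) :
    ∃ r : V →ₗ[ℂ] ι → ℂ, ∀ v, ρ v = Fintype.linearCombination ℂ L (r v) := by
  have hmem (v : V) : ρ v ∈ LinearMap.range (Fintype.linearCombination ℂ L) := by
    refine ⟨fun k => eval 0 (b.repr ⟨linVF (ρ v), hlog v⟩ k), Eq.symm ?_⟩
    refine eq_sum_eval_zero_smul (q := b.repr ⟨linVF (ρ v), hlog v⟩) ?_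
    simp only [← hL]
    exact (congrArg Subtype.val (b.sum_repr ⟨linVF (ρ v), hlog v⟩)).symm.trans
      (map_sum (logDer D).subtype _ _)
  obtain ⟨r, hr⟩ := Module.projective_lifting_property
    (Fintype.linearCombination ℂ L).rangeRestrict (ρ.codRestrict _ hmem)
    (LinearMap.surjective_rangeRestrict _)
  exact ⟨r, fun v => congrArg Subtype.val (LinearMap.congr_fun hr v).symm⟩

namespace IsLinearFreeDivisor

variable [Module.Finite ℂ V] (hD : IsLinearFreeDivisor D) {f : MvPolynomial ι ℂ}
  (hf : IsReducedEquation D f) (ρ : V →ₗ[ℂ] Module.End ℂ (ι → ℂ))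
  (hlog : ∀ v, linVF (ρ v) ∈ logDer D)
  (hrank : Fintype.card ι + Module.finrank ℂ (LinearMap.ker ρ) ≤ Module.finrank ℂ V)

include hD hf hlog hrank

theorem exists_section : ∃ (c : (ι → ℂ) →ₗ[ℂ] V) (r : V →ₗ[ℂ] ι → ℂ), (∀ w, r (c w) = w) ∧
    (∀ v, ρ (c (r v)) = ρ v) ∧
      Associated f (coeffMatrix fun k => linVF (ρ (c (Pi.single k 1)))).det := by
  obtain ⟨-, b, hb⟩ := hD
  choose L hL using fun k => (hb k).exists_eq_linVF
  obtain ⟨r, hr⟩ := exists_forall_eq_linearCombination hL hlog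
  have hker : LinearMap.ker r ≤ LinearMap.ker ρ := fun v hv => by
    rw [LinearMap.mem_ker] at hv ⊢
    rw [hr, hv, map_zero]
  have hsurj : LinearMap.range r = ⊤ := by
    refine Submodule.eq_top_of_finrank_eq (le_antisymm (Submodule.finrank_le _) ?_)
    have hadd := r.finrank_range_add_finrank_ker
    have hle := Submodule.finrank_mono hker
    rw [Module.finrank_fintype_fun_eq_card]
    omega
  obtain ⟨c, hc⟩ := r.exists_rightInverse_of_surjective hsurj
  have hrc (w : ι → ℂ) : r (c w) = w := LinearMap.congr_fun hc w
  refine ⟨c, r, hrc, fun v => by rw [hr, hrc, hr], ?_⟩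
  have hbasis : (fun k => linVF (ρ (c (Pi.single k 1)))) = fun k => (b k).1 := by
    funext k
    rw [hr, hrc, hL, Fintype.linearCombination_apply_single, one_smul]
  rw [hbasis]
  exact hf.associated_det_coeffMatrix b

theorem eq_zero_of_apply_eq_zero {y : ι → ℂ} (hy : y ∉ D) {v : V} (hv : ρ v y = 0) : ρ v = 0 := by
  obtain ⟨c, r, -, hρ, hdet⟩ := hD.exists_section hf ρ hlog hrank
  have hvec := vecMul_coeffMatrix_map_eval (ρ ∘ₗ c) (r v) y
  rw [LinearMap.comp_apply, hρ, hv] at hvec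
  have hr : r v = 0 := Matrix.vecMul_injective_iff_isUnit.mpr
    ((hf.isUnit_map_eval_iff hdet y).mpr hy) (hvec.trans (Matrix.zero_vecMul _).symm)
  rw [← hρ, hr, map_zero, map_zero]

theorem notMem_of_surjective {y : ι → ℂ} (hy : ∀ z, ∃ v, ρ v y = z) : y ∉ D := by
  obtain ⟨c, r, -, hρ, hdet⟩ := hD.exists_section hf ρ hlog hrank
  rw [← hf.isUnit_map_eval_iff hdet, ← Matrix.vecMul_surjective_iff_isUnit]
  intro z
  obtain ⟨v, rfl⟩ := hy z
  have hvec := vecMul_coeffMatrix_map_eval (ρ ∘ₗ c) (r v) y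
  rw [LinearMap.comp_apply, hρ] at hvec
  exact ⟨r v, hvec⟩

theorem linVF_eq_trace_sub_mul {v : V} {ad : V →ₗ[ℂ] V}
    (had : ∀ w, ρ (ad w) = ρ v * ρ w - ρ w * ρ v) (hadker : ∀ w, ρ w = 0 → ad w = 0) :
    linVF (ρ v) f = C (LinearMap.trace ℂ _ (ρ v) - LinearMap.trace ℂ V ad) * f := by
  obtain ⟨c, r, -, hρ, hdet⟩ := hD.exists_section hf ρ hlog hrank
  have had_comp : ad ∘ₗ c ∘ₗ r = ad := LinearMap.ext fun w => by
    rw [LinearMap.comp_apply, LinearMap.comp_apply, ← sub_eq_zero, ← map_sub]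
    exact hadker _ (by rw [map_sub, hρ, sub_self])
  have htrace : LinearMap.trace ℂ _ (r ∘ₗ ad ∘ₗ c) = LinearMap.trace ℂ V ad := by
    rw [LinearMap.trace_comp_comm', LinearMap.comp_assoc, had_comp]
  rw [← htrace]
  refine derivation_eq_C_mul_of_associated hdet (linVF_det_coeffMatrix (A := ρ ∘ₗ c) fun w => ?_)
  simp only [LinearMap.comp_apply, hρ, had]

end IsLinearFreeDivisor

end LinearVectorField

/-! ### A criterion for weak quasihomogeneity -/

section WeaklyQuasihomogeneous

open MvPolynomial

section LocalRing

variable {ι : Type}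

theorem valueAt_algebraMap (p : ι → ℂ) (g : MvPolynomial ι ℂ) :
    valueAt p (algebraMap _ _ g) = eval p g :=
  IsLocalization.lift_eq _ _

theorem partialAt_algebraMap (p : ι → ℂ) (j : ι) (g : MvPolynomial ι ℂ) :
    partialAt p j (algebraMap _ _ g) = algebraMap _ _ (pderiv j g) := by
  rw [← Localization.mk_one_eq_algebraMap, partialAt_mk, ← Localization.mk_one_eq_algebraMap]
  congr 1
  · simp
  · simp

theorem exists_mul_algebraMap_eq_one {p : ι → ℂ} {u : MvPolynomial ι ℂ} (hu : eval p u ≠ 0) :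
    ∃ w : LocalRingAt p, w * algebraMap _ _ u = 1 ∧ valueAt p w = (eval p u)⁻¹ := by
  have hunit : IsUnit (algebraMap (MvPolynomial ι ℂ) (LocalRingAt p) u) :=
    IsLocalization.map_units (M := (RingHom.ker (eval p)).primeCompl) (LocalRingAt p)
      ⟨u, by rwa [Ideal.mem_primeCompl_iff, RingHom.mem_ker]⟩
  obtain ⟨w, hw⟩ := hunit.exists_left_inv
  refine ⟨w, hw, eq_inv_of_mul_eq_one_left ?_⟩
  rw [← valueAt_algebraMap, ← map_mul, hw, map_one]

theorem IsReducedEquation.isLocalEquation {D : Set (ι → ℂ)} {f : MvPolynomial ι ℂ}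
    (hf : IsReducedEquation D f) (p : ι → ℂ) : IsLocalEquation D p (algebraMap _ _ f) := by
  rw [IsLocalEquation, hf.ideal_eq, Ideal.map_span, Set.image_singleton]

end LocalRing

variable {ι : Type} [Fintype ι] [DecidableEq ι]

theorem exists_mulVec_eq_smul_of_mem_spectrum_transpose {K : Matrix ι ι ℂ} {μ : ℂ}
    (h : μ ∈ spectrum ℂ K.transpose) : ∃ v ≠ 0, K.mulVec v = μ • v := by
  rw [spectrum.mem_iff, Matrix.isUnit_iff_isUnit_det, isUnit_iff_ne_zero, not_not,
    ← Matrix.det_transpose] at h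
  obtain ⟨v, hv, hKv⟩ := Matrix.exists_mulVec_eq_zero_iff.mpr h
  refine ⟨v, hv, ?_⟩
  rw [Matrix.transpose_sub, Matrix.transpose_transpose, Matrix.sub_mulVec, sub_eq_zero,
    Matrix.algebraMap_eq_diagonal, Matrix.diagonal_transpose] at hKv
  rw [← hKv]
  funext j
  simp [Matrix.mulVec_diagonal]

theorem linVF_X_eq_sum_sub_mul {L : Module.End ℂ (ι → ℂ)} {M : ι → ℂ} (hLM : L M = 0) (j : ι) :
    linVF L (X j) = ∑ i, (X i - C (M i)) * C (L (Pi.single i 1) j) := by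
  have hsum := linearMap_apply_eq_sum_mul_single (LinearMap.proj j ∘ₗ L) M
  rw [LinearMap.comp_apply, hLM, map_zero] at hsum
  rw [linVF_X, linForm_apply]
  simp only [sub_mul, Finset.sum_sub_distrib, ← C_mul, ← map_sum]
  change _ = _ - C (∑ i, M i * (LinearMap.proj j ∘ₗ L) (Pi.single i 1))
  rw [← hsum, C_0, sub_zero]
  exact Finset.sum_congr rfl fun i _ => mul_comm _ _

theorem mul_eq_sum_sub_mul_mul_pderiv {f : MvPolynomial ι ℂ} {M : ι → ℂ} {χ : ℂ} {r : ι → ℂ}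
    {L : Module.End ℂ (ι → ℂ)} {R : ι → Module.End ℂ (ι → ℂ)} (hLM : L M = 0)
    (hL : linVF L f = C χ * f) (hR : ∀ i, linVF (R i) f = C (r i) * f) :
    (C χ + ∑ i, (X i - C (M i)) * C (r i)) * f = ∑ i, ∑ j, (X i - C (M i)) *
      (C (L (Pi.single i 1) j) + linVF (R i) (X j)) * pderiv j f := by
  have hLf : linVF L f = ∑ i, ∑ j, (X i - C (M i)) * C (L (Pi.single i 1) j) * pderiv j f := by
    rw [derivation_eq_sum_mul_pderiv, Finset.sum_comm]
    simp only [linVF_X_eq_sum_sub_mul hLM, Finset.sum_mul]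
  have hRf (i : ι) : (X i - C (M i)) * C (r i) * f =
      ∑ j, (X i - C (M i)) * linVF (R i) (X j) * pderiv j f := by
    rw [mul_assoc, ← hR, derivation_eq_sum_mul_pderiv, Finset.mul_sum]
    simp only [mul_assoc]
  rw [add_mul, ← hL, hLf, Finset.sum_mul]
  simp only [hRf, mul_add, add_mul, Finset.sum_add_distrib]

-- `L + ∑ (x_i - M_i) R_i` vanishes at `M` with linear part `K`, and multiplies `f` by a unit there.
theorem IsReducedEquation.isWeaklyQuasihomogeneousAt {D : Set (ι → ℂ)} {f : MvPolynomial ι ℂ}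
    (hf : IsReducedEquation D f) {M : ι → ℂ} {L : Module.End ℂ (ι → ℂ)} {χ : ℝ} (hχ : 0 < χ)
    (hL : linVF L f = C (χ : ℂ) * f) (hLM : L M = 0) {R : ι → Module.End ℂ (ι → ℂ)}
    (hR : ∀ i, linVF (R i) ∈ logDer D) {K : Module.End ℂ (ι → ℂ)}
    (hK : ∀ i, K (Pi.single i 1) = L (Pi.single i 1) + R i M)
    (hspec : ∀ (μ : ℂ) (v : ι → ℂ), v ≠ 0 → K v = μ • v → ∃ r : ℝ, 0 ≤ r ∧ μ = r) :
    IsWeaklyQuasihomogeneousAt D M := by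
  choose r hr using fun i => hf.exists_linVF_eq_C_mul (hR i)
  have hχ₀ : (χ : ℂ) ≠ 0 := Complex.ofReal_ne_zero.mpr hχ.ne'
  have hvalue : eval M (C (χ : ℂ) + ∑ i, (X i - C (M i)) * C (r i)) = χ := by simp
  obtain ⟨w, hw, hw_value⟩ := exists_mul_algebraMap_eq_one (hvalue ▸ hχ₀)
  rw [hvalue] at hw_value
  refine ⟨algebraMap _ _ f, hf.isLocalEquation M, Matrix.of fun i j => w *
    algebraMap _ _ (C (L (Pi.single i 1) j) + linVF (R i) (X j)), ?_, fun μ hμ => ?_⟩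
  · have hf_eq : algebraMap _ _ f = w * algebraMap _ _ (∑ i, ∑ j, (X i - C (M i)) *
        (C (L (Pi.single i 1) j) + linVF (R i) (X j)) * pderiv j f) := by
      rw [← mul_eq_sum_sub_mul_mul_pderiv hLM hL hr, map_mul, ← mul_assoc, hw, one_mul]
    refine hf_eq.trans ?_
    simp only [map_sum, Finset.mul_sum, map_mul, Matrix.of_apply, partialAt_algebraMap]
    exact Finset.sum_congr rfl fun i _ => Finset.sum_congr rfl fun j _ => by ring
  · have hmatrix : Matrix.map (Matrix.of fun i j => w *
        algebraMap _ _ (C (L (Pi.single i 1) j) + linVF (R i) (X j))) (valueAt M) =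
        ((χ : ℂ)⁻¹ • LinearMap.toMatrix' K).transpose := by
      ext i j
      rw [Matrix.map_apply, Matrix.of_apply, map_mul, hw_value, valueAt_algebraMap]
      simp [LinearMap.toMatrix'_apply, hK]
    rw [hmatrix] at hμ
    obtain ⟨v, hv, hKv⟩ := exists_mulVec_eq_smul_of_mem_spectrum_transpose hμ
    rw [Matrix.smul_mulVec, LinearMap.toMatrix'_mulVec] at hKv
    obtain ⟨s, hs, hμs⟩ := hspec (χ * μ) v hv (by rw [← smul_smul, ← hKv, smul_inv_smul₀ hχ₀])
    refine ⟨s / χ, div_nonneg hs hχ.le, ?_⟩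
    rw [Complex.ofReal_div, ← hμs, mul_div_cancel_left₀ _ hχ₀]

end WeaklyQuasihomogeneous

/-! ### The infinitesimal action -/

section MatrixCalculus

open scoped Matrix.Norms.Operator

/-- The product of rectangular matrices as a continuous bilinear map. -/
noncomputable def matrixMul {l m n : Type*} [Fintype l] [Fintype m] [Fintype n] :
    Matrix l m ℂ →L[ℂ] Matrix m n ℂ →L[ℂ] Matrix l n ℂ :=
  LinearMap.toContinuousBilinearMap (LinearMap.mk₂ ℂ (· * ·) Matrix.add_mul Matrix.smul_mul
    Matrix.mul_add fun c A B => Matrix.mul_smul A c B)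

theorem hasStrictFDerivAt_matrix_inv_one {n : Type*} [Fintype n] [DecidableEq n] :
    HasStrictFDerivAt (fun A : Matrix n n ℂ => A⁻¹)
      (-ContinuousLinearMap.id ℂ (Matrix n n ℂ)) 1 := by
  simp only [Matrix.nonsing_inv_eq_ringInverse]
  refine (hasStrictFDerivAt_ringInverse (𝕜 := ℂ) (1 : (Matrix n n ℂ)ˣ)).congr_fderiv ?_
  ext1 A
  exact congrArg Neg.neg (show (1 : Matrix n n ℂ) * A * 1 = A by rw [one_mul, mul_one])

end MatrixCalculus

namespace RepSpace

variable {Q : Type} [Quiver.{0} Q] {d : Q → ℕ}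

variable (d) in
/-- The Lie algebra of `GL(Q, d)`. -/
abbrev LieAlg : Type := ∀ i : Q, Matrix (Fin (d i)) (Fin (d i)) ℂ

theorem ext_mat {x y : RepSpace Q d} (h : ∀ {i j : Q} (a : i ⟶ j), mat x a = mat y a) : x = y := by
  funext ⟨i, j, a, k, l⟩
  exact congrFun (congrFun (h a) k) l

/-- The map sending a point of the representation space to its matrix at the arrow `a`. -/
def matₗ {i j : Q} (a : i ⟶ j) : RepSpace Q d →ₗ[ℂ] Matrix (Fin (d j)) (Fin (d i)) ℂ where
  toFun x := mat x a
  map_add' _ _ := rfl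
  map_smul' _ _ := rfl

theorem mat_sub (x y : RepSpace Q d) {i j : Q} (a : i ⟶ j) : mat (x - y) a = mat x a - mat y a :=
  rfl

/-- The infinitesimal action of the Lie algebra of `GL(Q, d)`, see `mat_lieAct`. -/
noncomputable def lieAct : LieAlg d →ₗ[ℂ] Module.End ℂ (RepSpace Q d) :=
  LinearMap.mk₂ ℂ
    (fun ψ x c => (ψ c.2.1 * mat x c.2.2.1 - mat x c.2.2.1 * ψ c.1) c.2.2.2.1 c.2.2.2.2)
    (fun ψ φ x => ext_mat fun {i j} a => by
      change (ψ j + φ j) * mat x a - mat x a * (ψ i + φ i) =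
        (ψ j * mat x a - mat x a * ψ i) + (φ j * mat x a - mat x a * φ i)
      rw [Matrix.add_mul, Matrix.mul_add, add_sub_add_comm])
    (fun c ψ x => ext_mat fun {i j} a => by
      change (c • ψ j) * mat x a - mat x a * (c • ψ i) = c • (ψ j * mat x a - mat x a * ψ i)
      rw [Matrix.smul_mul, Matrix.mul_smul, smul_sub])
    (fun ψ x y => ext_mat fun {i j} a => by
      change ψ j * (mat x a + mat y a) - (mat x a + mat y a) * ψ i =
        (ψ j * mat x a - mat x a * ψ i) + (ψ j * mat y a - mat y a * ψ i)
      rw [Matrix.add_mul, Matrix.mul_add, add_sub_add_comm])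
    (fun c ψ x => ext_mat fun {i j} a => by
      change ψ j * (c • mat x a) - (c • mat x a) * ψ i = c • (ψ j * mat x a - mat x a * ψ i)
      rw [Matrix.smul_mul, Matrix.mul_smul, smul_sub])

theorem mat_lieAct (ψ : LieAlg d) (x : RepSpace Q d) {i j : Q} (a : i ⟶ j) :
    mat (lieAct ψ x) a = ψ j * mat x a - mat x a * ψ i := rfl

/-- The formula for the action of `GL(Q, d)`, extended to all tuples of square matrices by the
convention that singular matrices have inverse `0`. -/
noncomputable def tupleAct (A : LieAlg d) (x : RepSpace Q d) : RepSpace Q d :=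
  fun c => (A c.2.1 * mat x c.2.2.1 * (A c.1)⁻¹) c.2.2.2.1 c.2.2.2.2

theorem mat_tupleAct (A : LieAlg d) (x : RepSpace Q d) {i j : Q} (a : i ⟶ j) :
    mat (tupleAct A x) a = A j * mat x a * (A i)⁻¹ := rfl

theorem tupleAct_val (g : ∀ i, GL (Fin (d i)) ℂ) (x : RepSpace Q d) :
    tupleAct (fun i => (g i).1) x = act g x :=
  ext_mat fun a => by rw [mat_tupleAct, mat_act, Matrix.coe_units_inv]

theorem tupleAct_one (x : RepSpace Q d) : tupleAct 1 x = x :=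
  ext_mat fun a => by
    rw [mat_tupleAct, Pi.one_apply, Pi.one_apply, Matrix.one_mul, inv_one, Matrix.mul_one]

theorem tupleAct_mul (A B : LieAlg d) (x : RepSpace Q d) :
    tupleAct (A * B) x = tupleAct A (tupleAct B x) :=
  ext_mat fun a => by simp only [mat_tupleAct, Pi.mul_apply, Matrix.mul_inv_rev, Matrix.mul_assoc]

theorem tupleAct_smul {c : ℂ} (hc : c ≠ 0) {A : LieAlg d} (hA : IsUnit A) (x : RepSpace Q d) :
    tupleAct (c • A) x = tupleAct A x :=
  ext_mat fun {i j} a => by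
    have hdet : IsUnit (A i).det := (Matrix.isUnit_iff_isUnit_det _).mp (Pi.isUnit_iff.mp hA i)
    have hinv : (c • A i)⁻¹ = c⁻¹ • (A i)⁻¹ := by
      refine Matrix.inv_eq_left_inv ?_
      rw [Matrix.smul_mul, Matrix.mul_smul, smul_smul, inv_mul_cancel₀ hc, one_smul,
        Matrix.nonsing_inv_mul _ hdet]
    rw [mat_tupleAct, mat_tupleAct, Pi.smul_apply, Pi.smul_apply, hinv, Matrix.smul_mul,
      Matrix.smul_mul, Matrix.mul_smul, smul_smul, mul_inv_cancel₀ hc, one_smul]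

theorem exists_act_eq_tupleAct {A : LieAlg d} (hA : IsUnit A) :
    ∃ g : ∀ i, GL (Fin (d i)) ℂ, ∀ x : RepSpace Q d, act g x = tupleAct A x :=
  ⟨fun i => (Pi.isUnit_iff.mp hA i).unit, fun x => (tupleAct_val _ x).symm⟩

theorem act_mul (g h : ∀ i, GL (Fin (d i)) ℂ) (x : RepSpace Q d) :
    act (g * h) x = act g (act h x) := by
  simp only [← tupleAct_val, ← tupleAct_mul]
  rfl

theorem act_one (x : RepSpace Q d) : act 1 x = x := by
  rw [← tupleAct_val]
  exact tupleAct_one x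

theorem act_mem_iff {D : Set (RepSpace Q d)} {x₀ : RepSpace Q d}
    (hD : Dᶜ = Set.range fun g => act g x₀) (g : ∀ i, GL (Fin (d i)) ℂ) (x : RepSpace Q d) :
    act g x ∈ D ↔ x ∈ D := by
  have hcompl (g : ∀ i, GL (Fin (d i)) ℂ) (x : RepSpace Q d) (hx : x ∈ Dᶜ) : act g x ∈ Dᶜ := by
    rw [hD] at hx ⊢
    obtain ⟨h, rfl⟩ := hx
    exact ⟨g * h, act_mul g h x₀⟩
  refine not_iff_not.mp ⟨fun h => ?_, hcompl g x⟩
  rw [← act_one x, ← inv_mul_cancel g, act_mul]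
  exact hcompl g⁻¹ _ h

theorem tupleAct_mem_iff {D : Set (RepSpace Q d)} {x₀ : RepSpace Q d}
    (hD : Dᶜ = Set.range fun g => act g x₀) {A : LieAlg d} (hA : IsUnit A) (x : RepSpace Q d) :
    tupleAct A x ∈ D ↔ x ∈ D := by
  obtain ⟨g, hg⟩ := exists_act_eq_tupleAct (Q := Q) hA
  rw [← hg, act_mem_iff hD]

section Derivative

open scoped Matrix.Norms.Operator
open Topology

variable [Finite Q]

omit [Quiver Q] in
theorem eventually_isUnit_nhds_one : ∀ᶠ A in 𝓝 (1 : LieAlg d), IsUnit A := by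
  have := Fintype.ofFinite Q
  exact Units.nhds 1

variable [∀ i j : Q, Finite (i ⟶ j)]

theorem hasStrictFDerivAt_of_mat {E : Type*} [NormedAddCommGroup E] [NormedSpace ℂ E]
    {F : E → RepSpace Q d} {F' : E →L[ℂ] RepSpace Q d} {v : E}
    (h : ∀ {i j : Q} (a : i ⟶ j), HasStrictFDerivAt (fun w => mat (F w) a)
      ((matₗ a).toContinuousLinearMap ∘L F') v) : HasStrictFDerivAt F F' v := by
  have := Fintype.ofFinite (RepCoord Q d)
  exact hasStrictFDerivAt_pi'.mpr fun ⟨_, _, a, k, l⟩ =>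
    (Matrix.entryLinearMap ℂ ℂ k l).toContinuousLinearMap.hasStrictFDerivAt.comp v (h a)

theorem hasStrictFDerivAt_tupleAct_one (x : RepSpace Q d) :
    HasStrictFDerivAt (fun p : LieAlg d × RepSpace Q d => tupleAct p.1 p.2)
      (lieAct.flip x ∘ₗ LinearMap.fst ℂ (LieAlg d) (RepSpace Q d) +
        LinearMap.snd ℂ (LieAlg d) (RepSpace Q d)).toContinuousLinearMap (1, x) := by
  have := Fintype.ofFinite Q
  have := Fintype.ofFinite (RepCoord Q d)
  refine hasStrictFDerivAt_of_mat fun {i j} a => ?_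
  let proj (k : Q) : LieAlg d × RepSpace Q d →L[ℂ] Matrix (Fin (d k)) (Fin (d k)) ℂ :=
    (ContinuousLinearMap.proj k).comp (ContinuousLinearMap.fst ℂ (LieAlg d) (RepSpace Q d))
  let matA : LieAlg d × RepSpace Q d →L[ℂ] Matrix (Fin (d j)) (Fin (d i)) ℂ :=
    (matₗ a).toContinuousLinearMap.comp (ContinuousLinearMap.snd ℂ (LieAlg d) (RepSpace Q d))
  have hinv : HasStrictFDerivAt (fun p => (proj i p)⁻¹) (-proj i) (1, x) :=
    (HasStrictFDerivAt.comp (1, x) hasStrictFDerivAt_matrix_inv_one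
      (proj i).hasStrictFDerivAt).congr_fderiv
        (ContinuousLinearMap.ext fun _ => rfl)
  have hmul := matrixMul.hasStrictFDerivAt_of_bilinear (proj j).hasStrictFDerivAt
    (matA.hasStrictFDerivAt (x := (1, x)))
  refine (matrixMul.hasStrictFDerivAt_of_bilinear hmul hinv).congr_fderiv
    (ContinuousLinearMap.ext fun ⟨ψ, y⟩ => ?_)
  change (1 : Matrix (Fin (d j)) (Fin (d j)) ℂ) * mat x a * (-ψ i) +
    ((1 : Matrix (Fin (d j)) (Fin (d j)) ℂ) * mat y a + ψ j * mat x a) *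
      (1 : Matrix (Fin (d i)) (Fin (d i)) ℂ)⁻¹ = ψ j * mat x a - mat x a * ψ i + mat y a
  rw [inv_one, Matrix.one_mul, Matrix.one_mul, Matrix.mul_one, Matrix.mul_neg]
  abel

theorem hasDerivAt_tupleAct_one_add_smul (ψ : LieAlg d) (x : RepSpace Q d) :
    HasDerivAt (fun s : ℂ => tupleAct (1 + s • ψ) x) (lieAct ψ x) 0 := by
  have := Fintype.ofFinite Q
  have := Fintype.ofFinite (RepCoord Q d)
  have hcurve : HasDerivAt (fun s : ℂ => ((1 : LieAlg d) + s • ψ, x))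
      (ψ, (0 : RepSpace Q d)) 0 := by
    have hsmul := ((hasDerivAt_id (0 : ℂ)).smul_const ψ).const_add 1
    rw [one_smul] at hsmul
    exact hsmul.prodMk (hasDerivAt_const 0 x)
  have hact := (hasStrictFDerivAt_tupleAct_one x).hasFDerivAt
  rw [← add_zero (1 : LieAlg d), ← zero_smul ℂ ψ] at hact
  exact (hact.comp_hasDerivAt (f := fun s : ℂ => ((1 : LieAlg d) + s • ψ, x)) 0 hcurve).congr_deriv
    (add_zero (lieAct ψ x))

theorem differentiableAt_tupleAct {A : LieAlg d} (hA : IsUnit A) (x : RepSpace Q d) :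
    DifferentiableAt ℂ (fun B => tupleAct B x) A := by
  have := Fintype.ofFinite Q
  have := Fintype.ofFinite (RepCoord Q d)
  obtain ⟨u, rfl⟩ := hA
  have htranslate : (fun B => tupleAct B x) =
      (fun p : LieAlg d × RepSpace Q d => tupleAct p.1 p.2) ∘
        fun B => (B * ↑u⁻¹, tupleAct u.1 x) := by
    funext B
    rw [Function.comp_apply, ← tupleAct_mul, mul_assoc, Units.inv_mul, mul_one]
  have hone := (hasStrictFDerivAt_tupleAct_one (tupleAct u.1 x)).hasFDerivAt.differentiableAt
  rw [← u.mul_inv] at hone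
  rw [htranslate]
  exact hone.comp u.1 ((differentiableAt_id.mul_const _).prodMk (differentiableAt_const _))

theorem linVF_lieAct_mem_logDer [Fintype (RepCoord Q d)] [DecidableEq (RepCoord Q d)]
    {D : Set (RepSpace Q d)} {f : MvPolynomial (RepCoord Q d) ℂ} (hf : IsReducedEquation D f)
    {x₀ : RepSpace Q d} (hD : Dᶜ = Set.range fun g => act g x₀) (ψ : LieAlg d) :
    linVF (lieAct ψ) ∈ logDer D := by
  refine hf.linVF_mem_logDer fun x hx => ⟨fun s => tupleAct (1 + s • ψ) x, ?_, ?_,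
    hasDerivAt_tupleAct_one_add_smul ψ x⟩
  · simp only [zero_smul, add_zero, tupleAct_one]
  · have hcont : Filter.Tendsto (fun s : ℂ => 1 + s • ψ) (𝓝 0) (𝓝 1) :=
      Continuous.tendsto' (by fun_prop) _ _ (by rw [zero_smul, add_zero])
    exact (hcont.eventually eventually_isUnit_nhds_one).mono fun s hs =>
      (tupleAct_mem_iff hD hs x).mpr hx

end Derivative

theorem eq_smul_one_of_lieAct_eq_zero [Finite Q]
    (hker : ∀ g : ∀ i, GL (Fin (d i)) ℂ, (∀ x : RepSpace Q d, act g x = x) →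
      ∃ c : ℂ, ∀ i, (g i).1 = c • (1 : Matrix (Fin (d i)) (Fin (d i)) ℂ))
    {ψ : LieAlg d} (hψ : lieAct ψ = 0) : ∃ c : ℂ, ∀ i, ψ i = c • 1 := by
  have hfin : (⋃ i, spectrum ℂ (ψ i)).Finite := Set.finite_iUnion fun i => Matrix.finite_spectrum _
  obtain ⟨t, ht⟩ := hfin.exists_notMem
  have hunit (i : Q) : IsUnit (algebraMap ℂ (Matrix (Fin (d i)) (Fin (d i)) ℂ) t - ψ i) := by
    by_contra h
    exact ht (Set.mem_iUnion.mpr ⟨i, h⟩)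
  obtain ⟨c, hc⟩ := hker (fun i => (hunit i).unit) fun x => ext_mat fun {i j} a => by
    have hcomm : ψ j * mat x a - mat x a * ψ i = 0 := by
      rw [← mat_lieAct, hψ]
      rfl
    have hunit_comm : ((hunit j).unit : Matrix (Fin (d j)) (Fin (d j)) ℂ) * mat x a =
        mat x a * ((hunit i).unit : Matrix (Fin (d i)) (Fin (d i)) ℂ) := by
      rw [IsUnit.unit_spec, IsUnit.unit_spec, Matrix.sub_mul, Matrix.mul_sub, sub_eq_zero.mp hcomm,
        Algebra.algebraMap_eq_smul_one, Algebra.algebraMap_eq_smul_one, Matrix.smul_mul,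
        Matrix.mul_smul, Matrix.one_mul, Matrix.mul_one]
    rw [mat_act, hunit_comm, Matrix.mul_assoc, Units.mul_inv, Matrix.mul_one]
  refine ⟨t - c, fun i => ?_⟩
  rw [sub_smul, ← hc, IsUnit.unit_spec, Algebra.algebraMap_eq_smul_one, sub_sub_cancel]

end RepSpace

/-! ### The dimension of a group with an open orbit -/

open Topology MeasureTheory in
/-- Euler's relation: the derivative of a map which is homogeneous of degree `0` kills the radial
direction, so the map has zero Jacobian. -/
theorem addHaar_image_eq_zero_of_eventually_smul_eq {E : Type*} [NormedAddCommGroup E]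
    [NormedSpace ℝ E] [FiniteDimensional ℝ E] [MeasurableSpace E] [BorelSpace E] (μ : Measure E)
    [μ.IsAddHaarMeasure] {F : E → E} {U : Set E} (hF : ∀ y ∈ U, DifferentiableAt ℝ F y)
    (hscale : ∀ y ∈ U, ∀ᶠ s in 𝓝 (1 : ℝ), F (s • y) = F y) (hzero : (0 : E) ∉ U) :
    μ (F '' U) = 0 := by
  refine addHaar_image_eq_zero_of_det_fderivWithin_eq_zero μ
    (fun y hy => (hF y hy).hasFDerivAt.hasFDerivWithinAt) fun y hy => ?_
  refine (LinearMap.det_eq_zero_iff_ker_ne_bot (f := (fderiv ℝ F y).toLinearMap)).mpr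
    ((Submodule.ne_bot_iff _).mpr ⟨y, ?_, fun h => hzero (h ▸ hy)⟩)
  have hray : HasDerivAt (fun s : ℝ => s • y) y 1 := by
    simpa only [id, one_smul] using (hasDerivAt_id (1 : ℝ)).smul_const y
  have hFy : HasFDerivAt F (fderiv ℝ F y) ((1 : ℝ) • y) := by
    rw [one_smul]
    exact (hF y hy).hasFDerivAt
  exact (hFy.comp_hasDerivAt (1 : ℝ) hray).unique
    ((hasDerivAt_const 1 (F y)).congr_of_eventuallyEq (hscale y hy))

theorem trace_mulLeft_sub_mulRight {Q R : Type*} [Finite Q] [CommRing R] {n : Q → Type*}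
    [∀ i, Fintype (n i)] (A : ∀ i, Matrix (n i) (n i) R) :
    LinearMap.trace R _ (LinearMap.mulLeft R A - LinearMap.mulRight R A) = 0 := by
  classical
  have := Fintype.ofFinite Q
  let b := Pi.basis fun i => Matrix.stdBasis R (n i) (n i)
  have hdiag (i : Q) (k l : n i) : (LinearMap.toMatrix b b
      (LinearMap.mulLeft R A - LinearMap.mulRight R A)).diag ⟨i, k, l⟩ =
      A i k k - A i l l := by
    have hbracket : (LinearMap.mulLeft R A - LinearMap.mulRight R A) (b ⟨i, k, l⟩) i =
        A i * Matrix.single k l 1 - Matrix.single k l 1 * A i := by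
      simp [b, Matrix.stdBasis_eq_single]
    rw [Matrix.diag_apply, LinearMap.toMatrix_apply, Pi.basis_repr, hbracket]
    change (A i * Matrix.single k l 1 - Matrix.single k l 1 * A i : Matrix (n i) (n i) R) k l = _
    simp
  rw [LinearMap.trace_eq_matrix_trace R b, Matrix.trace, Fintype.sum_sigma]
  refine Finset.sum_eq_zero fun i _ => ?_
  simp only [hdiag, Fintype.sum_prod_type, Finset.sum_sub_distrib]
  rw [Finset.sum_comm, sub_self]

namespace RepSpace

variable {Q : Type} [Quiver.{0} Q] {d : Q → ℕ}

open scoped Matrix.Norms.Operator in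
/-- If the group were not larger than the space, an orbit map would be a map between spaces of the
same dimension; as the scalars act trivially its Jacobian vanishes, so by Sard's lemma the orbit
would have measure zero. -/
theorem card_lt_finrank_lieAlg [Finite Q] [Fintype (RepCoord Q d)] [∀ i j : Q, Finite (i ⟶ j)]
    [Nontrivial (LieAlg d)] {x₀ : RepSpace Q d}
    (hopen : (interior (Set.range fun g => act g x₀)).Nonempty) :
    Fintype.card (RepCoord Q d) < Module.finrank ℂ (LieAlg d) := by
  have := Fintype.ofFinite Q
  by_contra! hle
  rw [← Module.finrank_fintype_fun_eq_card ℂ] at hle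
  obtain ⟨q, hq⟩ := finrank_le_iff_exists_linearMap.mp hle
  obtain ⟨p, hp⟩ := q.exists_leftInverse_of_injective (LinearMap.ker_eq_bot.mpr hq)
  have hpq (A : LieAlg d) : p (q A) = A := LinearMap.congr_fun hp A
  have hnull : MeasureTheory.volume ((fun y => tupleAct (p y) x₀) '' {y | IsUnit (p y)}) = 0 := by
    refine addHaar_image_eq_zero_of_eventually_smul_eq _ (fun y hy => ?_) (fun y hy => ?_) ?_
    · have hdiff : DifferentiableAt ℂ p y := p.toContinuousLinearMap.differentiableAt
      exact ((differentiableAt_tupleAct hy x₀).comp y hdiff).restrictScalars ℝ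
    · filter_upwards [eventually_ne_nhds (one_ne_zero (α := ℝ))] with s hs
      rw [← Complex.coe_smul, map_smul, tupleAct_smul (Complex.ofReal_ne_zero.mpr hs) hy]
    · rw [Set.mem_ofPred_eq, map_zero]
      exact not_isUnit_zero
  have horbit : (Set.range fun g => act g x₀) ⊆
      (fun y => tupleAct (p y) x₀) '' {y | IsUnit (p y)} := by
    rintro _ ⟨g, rfl⟩
    refine ⟨q fun i => (g i).1, ?_, ?_⟩
    · rw [Set.mem_ofPred_eq, hpq]
      exact Pi.isUnit_iff.mpr fun i => (g i).isUnit
    · simp only [hpq, tupleAct_val]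
  exact (isOpen_interior.measure_pos _ hopen).ne'
    (MeasureTheory.measure_mono_null (interior_subset.trans horbit) hnull)

theorem finrank_ker_lieAct_le_one [Finite Q]
    (hker : ∀ g : ∀ i, GL (Fin (d i)) ℂ, (∀ x : RepSpace Q d, act g x = x) →
      ∃ c : ℂ, ∀ i, (g i).1 = c • (1 : Matrix (Fin (d i)) (Fin (d i)) ℂ)) :
    Module.finrank ℂ (LinearMap.ker (lieAct : LieAlg d →ₗ[ℂ] Module.End ℂ (RepSpace Q d))) ≤ 1 := by
  have hle : LinearMap.ker (lieAct : LieAlg d →ₗ[ℂ] Module.End ℂ (RepSpace Q d)) ≤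
      Submodule.span ℂ {(1 : LieAlg d)} := by
    intro ψ hψ
    obtain ⟨c, hc⟩ := eq_smul_one_of_lieAct_eq_zero hker hψ
    exact Submodule.mem_span_singleton.mpr ⟨c, funext fun i => (hc i).symm⟩
  exact (Submodule.finrank_mono hle).trans ((finrank_span_le_card _).trans (by simp))

theorem lieAct_mul_sub_mul (ψ θ : LieAlg d) :
    lieAct (ψ * θ - θ * ψ) = lieAct ψ * lieAct θ - lieAct θ * lieAct ψ := by
  refine LinearMap.ext fun x => ext_mat fun {i j} a => ?_
  change (ψ j * θ j - θ j * ψ j) * mat x a - mat x a * (ψ i * θ i - θ i * ψ i) =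
    (ψ j * (θ j * mat x a - mat x a * θ i) - (θ j * mat x a - mat x a * θ i) * ψ i) -
      (θ j * (ψ j * mat x a - mat x a * ψ i) - (ψ j * mat x a - mat x a * ψ i) * θ i)
  simp only [Matrix.mul_sub, Matrix.sub_mul, Matrix.mul_assoc]
  abel

end RepSpace

/-! ### Graded maps -/

section GradedMap

variable {K V W : Type*} [Field K] [AddCommGroup V] [Module K V] [AddCommGroup W] [Module K W]
  {p p' : Module.End K V} {P P' : Module.End K W} {c : V →ₗ[K] W}

theorem exists_isIdempotentElem_sub_add_comp (hP : IsIdempotentElem P)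
    (hc : ∀ v, c (p v) = P (c v)) (hsurj : ∀ w, ∃ v, c v = P' w) :
    ∃ R : W →ₗ[K] V, IsIdempotentElem (P - P' + c ∘ₗ R) := by
  obtain ⟨s, hs⟩ := c.rangeRestrict.exists_rightInverse_of_surjective c.range_rangeRestrict
  obtain ⟨π, hπ⟩ := (LinearMap.range c).subtype.exists_leftInverse_of_injective
    (Submodule.ker_subtype _)
  have hcs (x : LinearMap.range c) : c (s x) = x := congrArg Subtype.val (LinearMap.congr_fun hs x)
  have hπc (v : V) : π (c v) = ⟨c v, v, rfl⟩ := LinearMap.congr_fun hπ ⟨c v, v, rfl⟩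
  have hsum (w : W) : (P - P' + c ∘ₗ s ∘ₗ π ∘ₗ (P' - P)) w = P w - π (P w) := by
    obtain ⟨v, hv⟩ := hsurj w
    simp only [LinearMap.add_apply, LinearMap.sub_apply, LinearMap.comp_apply, hcs, map_sub, ← hv,
      hπc]
    abel
  refine ⟨s ∘ₗ π ∘ₗ (P' - P), LinearMap.ext fun w => ?_⟩
  have hPP : P (P w) = P w := LinearMap.congr_fun hP.eq w
  have hπP : π (P (π (P w))) = P (π (P w)) := by
    rw [← hcs (π (P w)), ← hc, hπc]
  rw [Module.End.mul_apply, hsum, hsum, map_sub, hPP, map_sub, Submodule.coe_sub, hπP]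
  abel

-- `P` and `P'` are the projections to the degrees `1` and `-1` of `W`, and `p`, `p'` those of `V`.
theorem exists_natCast_eq_trace_sub_of_graded [CharZero K] [Module.Finite K V] [Module.Finite K W]
    (hp : IsIdempotentElem p) (hp' : IsIdempotentElem p') (hP : IsIdempotentElem P)
    (hP' : IsIdempotentElem P') (hc : ∀ v, c (p v) = P (c v)) (hc' : ∀ v, c (p' v) = P' (c v))
    (hinj : ∀ v, c v = 0 → p v = 0) (hsurj : ∀ w, ∃ v, c v = P' w)
    (htr : LinearMap.trace K V (p - p') = 0) :
    ∃ n : ℕ, LinearMap.trace K W (P - P') = n ∧ (n = 0 → ∀ w, ∃ v, c v = P w) := by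
  have hrank : Module.finrank K (LinearMap.range p) = Module.finrank K (LinearMap.range p') := by
    rw [map_sub, (LinearMap.IsIdempotentElem.isProj_range _ hp).trace,
      (LinearMap.IsIdempotentElem.isProj_range _ hp').trace, sub_eq_zero] at htr
    exact_mod_cast htr
  have hmap : (LinearMap.range p).map c ≤ LinearMap.range P := by
    rintro _ ⟨_, ⟨v, rfl⟩, rfl⟩
    exact ⟨c v, (hc v).symm⟩
  have hmap' : LinearMap.range P' ≤ (LinearMap.range p').map c := by
    rintro _ ⟨w, rfl⟩
    obtain ⟨v, hv⟩ := hsurj w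
    exact ⟨p' v, ⟨v, rfl⟩, by rw [hc', hv]; exact LinearMap.congr_fun hP'.eq w⟩
  have hrank_map : Module.finrank K ((LinearMap.range p).map c) =
      Module.finrank K (LinearMap.range p) := by
    rw [← LinearMap.range_domRestrict]
    refine LinearMap.finrank_range_of_inj (LinearMap.ker_eq_bot.mp (LinearMap.ker_eq_bot'.mpr ?_))
    rintro ⟨_, v, rfl⟩ hv
    have hpp : p (p v) = p v := LinearMap.congr_fun hp.eq v
    exact Subtype.ext (hpp.symm.trans (hinj _ hv))
  have hle := Submodule.finrank_mono hmap
  have hle' := (Submodule.finrank_mono hmap').trans (Submodule.finrank_map_le c _)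
  refine ⟨Module.finrank K (LinearMap.range P) - Module.finrank K (LinearMap.range P'), ?_,
    fun hzero w => ?_⟩
  · rw [map_sub, (LinearMap.IsIdempotentElem.isProj_range _ hP).trace,
      (LinearMap.IsIdempotentElem.isProj_range _ hP').trace, Nat.cast_sub (by omega)]
  · obtain ⟨v, -, hv⟩ : P w ∈ (LinearMap.range p).map c :=
      Submodule.eq_of_le_of_finrank_le hmap (by omega) ▸ LinearMap.mem_range_self P w
    exact ⟨v, hv⟩

end GradedMap

/-! ### Idempotents in the isotropy algebra -/

namespace RepSpace

variable {Q : Type} [Quiver.{0} Q] {d : Q → ℕ}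

/-- The linear map `η ↦ (x_j η_a y_i)_{a : i → j}` on the representation space, the counterpart of
`LinearMap.mulLeftRight` on the Lie algebra. -/
noncomputable def mulLeftRight (x y : LieAlg d) : Module.End ℂ (RepSpace Q d) where
  toFun η c := (x c.2.1 * mat η c.2.2.1 * y c.1) c.2.2.2.1 c.2.2.2.2
  map_add' η ζ := ext_mat fun {i j} a => by
    change x j * (mat η a + mat ζ a) * y i = x j * mat η a * y i + x j * mat ζ a * y i
    rw [Matrix.mul_add, Matrix.add_mul]
  map_smul' s η := ext_mat fun {i j} a => by
    change x j * (s • mat η a) * y i = s • (x j * mat η a * y i)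
    rw [Matrix.mul_smul, Matrix.smul_mul]

theorem mat_mulLeftRight (x y : LieAlg d) (η : RepSpace Q d) {i j : Q} (a : i ⟶ j) :
    mat (mulLeftRight x y η) a = x j * mat η a * y i := rfl

theorem mulLeftRight_mulLeftRight (x y z t : LieAlg d) (η : RepSpace Q d) :
    mulLeftRight x y (mulLeftRight z t η) = mulLeftRight (x * z) (t * y) η :=
  ext_mat fun a => by simp only [mat_mulLeftRight, Pi.mul_apply, Matrix.mul_assoc]

theorem mulLeftRight_zero_left (y : LieAlg d) (η : RepSpace Q d) : mulLeftRight 0 y η = 0 :=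
  ext_mat fun {i j} a => by
    rw [mat_mulLeftRight, Pi.zero_apply, Matrix.zero_mul, Matrix.zero_mul]
    rfl

theorem isIdempotentElem_mulLeftRight {x y : LieAlg d} (hx : IsIdempotentElem x)
    (hy : IsIdempotentElem y) :
    IsIdempotentElem (mulLeftRight x y : Module.End ℂ (RepSpace Q d)) :=
  LinearMap.ext fun η => by rw [Module.End.mul_apply, mulLeftRight_mulLeftRight, hx.eq, hy.eq]

theorem lieAct_eq_mulLeftRight_sub (e : LieAlg d) : (lieAct e : Module.End ℂ (RepSpace Q d)) =
    mulLeftRight e (1 - e) - mulLeftRight (1 - e) e := by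
  refine LinearMap.ext fun η => ext_mat fun {i j} a => ?_
  rw [LinearMap.sub_apply, mat_sub, mat_mulLeftRight, mat_mulLeftRight, mat_lieAct, Pi.sub_apply,
    Pi.sub_apply, Pi.one_apply, Pi.one_apply, Matrix.mul_sub, Matrix.sub_mul, Matrix.sub_mul,
    Matrix.mul_one, Matrix.one_mul]
  abel

theorem lieAct_one : (lieAct 1 : Module.End ℂ (RepSpace Q d)) = 0 :=
  LinearMap.ext fun x => ext_mat fun {i j} a => by
    rw [mat_lieAct, Pi.one_apply, Pi.one_apply, Matrix.one_mul, Matrix.mul_one, sub_self]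
    rfl

theorem lieAct_apply_eq_zero_iff {ψ : LieAlg d} {x : RepSpace Q d} :
    lieAct ψ x = 0 ↔ ∀ {i j : Q} (a : i ⟶ j), ψ j * mat x a = mat x a * ψ i :=
  ⟨fun h {_ _} a => sub_eq_zero.mp (congrArg (fun z => mat z a) h),
    fun h => ext_mat fun a => sub_eq_zero.mpr (h a)⟩

theorem lieAct_mulLeftRight {M : RepSpace Q d} {x y : LieAlg d} (hx : lieAct x M = 0)
    (hy : lieAct y M = 0) (θ : LieAlg d) :
    lieAct (LinearMap.mulLeftRight ℂ (x, y) θ) M = mulLeftRight x y (lieAct θ M) :=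
  ext_mat fun {i j} a => by
    rw [lieAct_apply_eq_zero_iff] at hx hy
    rw [mat_lieAct, mat_mulLeftRight, mat_lieAct, LinearMap.mulLeftRight_apply]
    simp only [Pi.mul_apply]
    rw [Matrix.mul_sub, Matrix.sub_mul, Matrix.mul_assoc (x j * θ j), hy a,
      ← Matrix.mul_assoc (x j) (mat M a), hx a]
    simp only [Matrix.mul_assoc]

theorem exists_toLin'_eq (M : RepSpace Q d) (φ : ∀ i, M.toQRep.V i →ₗ[ℂ] M.toQRep.V i) :
    ∃ ψ : LieAlg d, (fun i => Matrix.toLin' (ψ i)) = φ :=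
  ⟨fun i => LinearMap.toMatrix' (n := Fin (d i)) (φ i), funext fun _ => Matrix.toLin'_toMatrix' _⟩

theorem toLin'_mat_lieAct (ψ : LieAlg d) (M : RepSpace Q d) {i j : Q} (a : i ⟶ j) :
    Matrix.toLin' (mat (lieAct ψ M) a) =
      QRep.ringel M.toQRep M.toQRep (fun i => Matrix.toLin' (ψ i)) i j a := by
  rw [mat_lieAct, map_sub, Matrix.toLin'_mul, Matrix.toLin'_mul]
  rfl

theorem exists_lieAct_eq_of_subsingleton_ext {M : RepSpace Q d}
    (h : Subsingleton (QRep.Ext M.toQRep M.toQRep)) (z : RepSpace Q d) : ∃ ψ, lieAct ψ M = z := by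
  obtain ⟨φ, hφ⟩ := QRep.subsingleton_ext_iff.mp h fun i j a => Matrix.toLin' (mat z a)
  obtain ⟨ψ, rfl⟩ := exists_toLin'_eq M φ
  exact ⟨ψ, ext_mat fun a => Matrix.toLin'.injective
    ((toLin'_mat_lieAct ψ M a).trans (congrFun (congrFun (congrFun hφ _) _) a))⟩

open scoped Matrix.Norms.Operator in
theorem exists_mem_slice_of_dense [Finite Q] [∀ i j : Q, Finite (i ⟶ j)] {M : RepSpace Q d}
    {U : Set (RepSpace Q d)} (hU : Dense U) (hact : ∀ g x, act g x ∈ U → x ∈ U)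
    (S : Submodule ℂ (RepSpace Q d)) (hS : ∀ w, ∃ ψ, ∃ s ∈ S, lieAct ψ M + s = w) :
    ∃ s ∈ S, M + s ∈ U := by
  have := Fintype.ofFinite Q
  have := Fintype.ofFinite (RepCoord Q d)
  let A : LieAlg d × S →L[ℂ] LieAlg d × RepSpace Q d :=
    (ContinuousLinearMap.id ℂ (LieAlg d)).prodMap S.subtypeL
  have hact_one := hasStrictFDerivAt_tupleAct_one M
  rw [← add_zero ((1, M) : LieAlg d × RepSpace Q d), ← map_zero A] at hact_one
  have hslice := hact_one.comp (f := fun q => (1, M) + A q) 0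
    (A.hasStrictFDerivAt.const_add ((1, M) : LieAlg d × RepSpace Q d))
  have hmap := hslice.map_nhds_eq_of_surj (LinearMap.range_eq_top.mpr fun w => by
    obtain ⟨ψ, s, hs, hw⟩ := hS w
    exact ⟨(ψ, ⟨s, hs⟩), hw⟩)
  have hunit : ∀ᶠ q : LieAlg d × S in nhds 0, IsUnit (1 + q.1) := by
    have hcont : Filter.Tendsto (fun q : LieAlg d × S => 1 + q.1) (nhds 0) (nhds 1) :=
      Continuous.tendsto' (by fun_prop) _ _ (add_zero 1)
    exact hcont.eventually eventually_isUnit_nhds_one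
  obtain ⟨_, hy, q, hq, rfl⟩ := hU.inter_nhds_nonempty (hmap ▸ Filter.image_mem_map hunit)
  obtain ⟨g, hg⟩ := exists_act_eq_tupleAct (Q := Q) hq
  exact ⟨q.2, q.2.2, hact g _ (hg (M + q.2) ▸ hy)⟩

/-- The matrix form of `QRep.IsOrthogonalProjection`: `e` is the projection of `M` to a summand with
complement `N` such that `e M` and `N` are nonzero, `Ext(e M, N) = 0` and `Hom(N, e M) = 0`. -/
structure IsOrthogonalIdempotent (M : RepSpace Q d) (e : LieAlg d) : Prop where
  idem : IsIdempotentElem e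
  ne_zero : e ≠ 0
  ne_one : e ≠ 1
  lieAct_eq_zero : lieAct e M = 0
  ext : ∀ η : RepSpace Q d, ∃ ψ, lieAct ψ M = mulLeftRight (1 - e) e η
  hom : ∀ ψ, lieAct ψ M = 0 → LinearMap.mulLeftRight ℂ (e, 1 - e) ψ = 0

theorem exists_isOrthogonalIdempotent {M : RepSpace Q d} (h : M.toQRep.HasOrthogonalSplitting) :
    ∃ e, IsOrthogonalIdempotent M e := by
  obtain ⟨⟨app, comm⟩, hidem, ⟨i₀, hne_zero⟩, ⟨i₁, hne_id⟩, hext, hhom⟩ := h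
  obtain ⟨e, rfl⟩ := exists_toLin'_eq M app
  refine ⟨e, ⟨funext fun i => Matrix.toLin'.injective ?_, ?_, ?_, ?_, fun η => ?_, fun ψ hψ => ?_⟩⟩
  · exact (Matrix.toLin'_mul _ _).trans (LinearMap.ext (hidem i))
  · rintro rfl
    exact hne_zero (map_zero Matrix.toLin')
  · rintro rfl
    exact hne_id Matrix.toLin'_one
  · refine lieAct_apply_eq_zero_iff.mpr fun a => Matrix.toLin'.injective ?_
    rw [Matrix.toLin'_mul, Matrix.toLin'_mul]
    exact (comm a).symm
  · obtain ⟨φ, hφ⟩ := hext fun i j a => Matrix.toLin' (mat η a)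
    obtain ⟨ψ, rfl⟩ := exists_toLin'_eq M φ
    refine ⟨ψ, ext_mat fun a => Matrix.toLin'.injective ?_⟩
    rw [toLin'_mat_lieAct, hφ, mat_mulLeftRight, Matrix.mul_assoc, Matrix.toLin'_mul,
      Matrix.toLin'_mul, Pi.sub_apply, map_sub, Pi.one_apply, Matrix.toLin'_one]
    rfl
  · have hcomm {i j : Q} (a : i ⟶ j) : Matrix.toLin' (mat M a) ∘ₗ Matrix.toLin' (ψ i) =
        Matrix.toLin' (ψ j) ∘ₗ Matrix.toLin' (mat M a) := by
      rw [← Matrix.toLin'_mul, ← Matrix.toLin'_mul, lieAct_apply_eq_zero_iff.mp hψ a]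
    refine funext fun i => Matrix.toLin'.injective ?_
    rw [LinearMap.mulLeftRight_apply, Pi.mul_apply, Pi.mul_apply, mul_assoc, Matrix.toLin'_mul,
      Matrix.toLin'_mul, Pi.sub_apply, map_sub, Pi.one_apply, Matrix.toLin'_one, Pi.zero_apply,
      map_zero]
    exact hhom ⟨fun i => Matrix.toLin' (ψ i), hcomm⟩ i

namespace IsOrthogonalIdempotent

variable {M : RepSpace Q d} {e : LieAlg d}

theorem lieAct_one_sub (he : IsOrthogonalIdempotent M e) : lieAct (1 - e) M = 0 := by
  rw [map_sub, LinearMap.sub_apply, lieAct_one, he.lieAct_eq_zero, LinearMap.zero_apply, sub_zero]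

theorem exists_natCast_eq_trace_lieAct [Finite Q] [Finite (RepCoord Q d)]
    (he : IsOrthogonalIdempotent M e) : ∃ n : ℕ, LinearMap.trace ℂ (RepSpace Q d) (lieAct e) = n ∧
      (n = 0 → ∀ w, ∃ ψ, lieAct ψ M = mulLeftRight e (1 - e) w) := by
  have hsplit : LinearMap.mulLeftRight ℂ (e, 1 - e) - LinearMap.mulLeftRight ℂ (1 - e, e) =
      LinearMap.mulLeft ℂ e - LinearMap.mulRight ℂ e := by
    refine LinearMap.ext fun θ => ?_
    simp only [LinearMap.sub_apply, LinearMap.mulLeftRight_apply, LinearMap.mulLeft_apply,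
      LinearMap.mulRight_apply]
    noncomm_ring
  have hmul {x y : LieAlg d} (hx : IsIdempotentElem x) (hy : IsIdempotentElem y) :
      IsIdempotentElem (LinearMap.mulLeftRight ℂ (x, y)) := LinearMap.ext fun θ => by
    simp only [Module.End.mul_apply, LinearMap.mulLeftRight_apply]
    rw [mul_assoc x θ y, ← mul_assoc x x, hx.eq, mul_assoc x (θ * y), mul_assoc θ y y, hy.eq]
  rw [lieAct_eq_mulLeftRight_sub]
  exact exists_natCast_eq_trace_sub_of_graded (c := lieAct.flip M) (hmul he.idem he.idem.one_sub)
    (hmul he.idem.one_sub he.idem) (isIdempotentElem_mulLeftRight he.idem he.idem.one_sub)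
    (isIdempotentElem_mulLeftRight he.idem.one_sub he.idem)
    (lieAct_mulLeftRight he.lieAct_eq_zero he.lieAct_one_sub)
    (lieAct_mulLeftRight he.lieAct_one_sub he.lieAct_eq_zero) he.hom he.ext
    (hsplit ▸ trace_mulLeft_sub_mulRight e)

theorem exists_isIdempotentElem_lieAct_add_comp (he : IsOrthogonalIdempotent M e) :
    ∃ R : RepSpace Q d →ₗ[ℂ] LieAlg d, IsIdempotentElem (lieAct e + lieAct.flip M ∘ₗ R) := by
  rw [lieAct_eq_mulLeftRight_sub]
  exact exists_isIdempotentElem_sub_add_comp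
    (isIdempotentElem_mulLeftRight he.idem he.idem.one_sub)
    (lieAct_mulLeftRight he.lieAct_eq_zero he.lieAct_one_sub) he.ext

theorem exists_mem_lieAct_eq_zero [Finite Q] [∀ i j : Q, Finite (i ⟶ j)]
    (he : IsOrthogonalIdempotent M e) (hsurj : ∀ w, ∃ ψ, lieAct ψ M = mulLeftRight e (1 - e) w)
    {U : Set (RepSpace Q d)} (hU : Dense U) (hact : ∀ g x, act g x ∈ U → x ∈ U) :
    ∃ y ∈ U, lieAct e y = 0 := by
  obtain ⟨s, hs, hsU⟩ := exists_mem_slice_of_dense (M := M) hU hact (LinearMap.ker (lieAct e))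
    fun w => by
      obtain ⟨ψ, hψ⟩ := hsurj w
      obtain ⟨θ, hθ⟩ := he.ext w
      refine ⟨ψ + θ, w - lieAct (ψ + θ) M, ?_, add_sub_cancel _ _⟩
      have he_mul : e * (1 - e) = 0 := by rw [mul_sub, he.idem.eq, mul_one, sub_self]
      have hmul_e : (1 - e) * e = 0 := by rw [sub_mul, he.idem.eq, one_mul, sub_self]
      rw [LinearMap.mem_ker, map_add, LinearMap.add_apply, hψ, hθ, lieAct_eq_mulLeftRight_sub]
      simp only [LinearMap.sub_apply, map_sub, map_add, mulLeftRight_mulLeftRight, he.idem.eq,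
        he.idem.one_sub.eq, he_mul, hmul_e, mulLeftRight_zero_left]
      abel
  exact ⟨M + s, hsU, by rw [map_add, he.lieAct_eq_zero, zero_add]; exact hs⟩

end IsOrthogonalIdempotent

end RepSpace

/-! ### Linear free divisors of quivers -/

namespace DefinesLinearFreeDivisor

open RepSpace

variable {Q : Type} [Fintype Q] [DecidableEq Q] [Quiver.{0} Q] [∀ i j : Q, Fintype (i ⟶ j)]
  [∀ i j : Q, DecidableEq (i ⟶ j)] {d : Q → ℕ} {D : Set (RepSpace Q d)}
  (hD : DefinesLinearFreeDivisor d D) {f : MvPolynomial (RepCoord Q d) ℂ}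

include hD

theorem nontrivial_lieAlg [Nonempty Q] : Nontrivial (LieAlg d) := by
  have i₀ := Classical.arbitrary Q
  have : Nonempty (Fin (d i₀)) := ⟨⟨0, hD.sincere i₀⟩⟩
  exact Pi.nontrivial_at i₀

theorem eq_algebraMap_of_lieAct_eq_zero {ψ : LieAlg d}
    (hψ : (lieAct ψ : Module.End ℂ (RepSpace Q d)) = 0) :
    ∃ c : ℂ, ψ = algebraMap ℂ (LieAlg d) c := by
  obtain ⟨c, hc⟩ := eq_smul_one_of_lieAct_eq_zero (fun g => (hD.group_kernel g).mp) hψ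
  exact ⟨c, (funext hc).trans (Algebra.algebraMap_eq_smul_one c).symm⟩

theorem card_add_finrank_ker_lieAct_le [Nonempty Q] : Fintype.card (RepCoord Q d) +
    Module.finrank ℂ (LinearMap.ker (lieAct : LieAlg d →ₗ[ℂ] Module.End ℂ (RepSpace Q d))) ≤
      Module.finrank ℂ (LieAlg d) := by
  have := hD.nontrivial_lieAlg
  obtain ⟨x₀, hx₀⟩ := hD.discriminant
  have hcard := card_lt_finrank_lieAlg (x₀ := x₀) (by
    rw [← hx₀, hD.linearFree.1.isClosed.isOpen_compl.interior_eq]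
    exact hD.linearFree.1.dense_compl.nonempty)
  have hker := finrank_ker_lieAct_le_one (Q := Q) (d := d) fun g => (hD.group_kernel g).mp
  omega

theorem linVF_lieAct_mem_logDer (hf : IsReducedEquation D f) (ψ : LieAlg d) :
    linVF (lieAct ψ) ∈ logDer D := by
  obtain ⟨x₀, hx₀⟩ := hD.discriminant
  exact RepSpace.linVF_lieAct_mem_logDer hf hx₀ ψ

theorem linVF_lieAct_eq_trace_mul [Nonempty Q] (hf : IsReducedEquation D f) (ψ : LieAlg d) :
    linVF (lieAct ψ) f = MvPolynomial.C (LinearMap.trace ℂ (RepSpace Q d) (lieAct ψ)) * f := by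
  rw [hD.linearFree.linVF_eq_trace_sub_mul hf lieAct (hD.linVF_lieAct_mem_logDer hf)
    hD.card_add_finrank_ker_lieAct_le (ad := LinearMap.mulLeft ℂ ψ - LinearMap.mulRight ℂ ψ)
    (lieAct_mul_sub_mul ψ) fun θ hθ => ?_, trace_mulLeft_sub_mulRight, sub_zero]
  obtain ⟨c, rfl⟩ := hD.eq_algebraMap_of_lieAct_eq_zero hθ
  exact sub_eq_zero.mpr (Algebra.commutes c ψ).symm

theorem notMem_of_subsingleton_ext [Nonempty Q] {x : RepSpace Q d}
    (hx : Subsingleton (QRep.Ext x.toQRep x.toQRep)) : x ∉ D := by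
  obtain ⟨f, hf⟩ := hD.linearFree.1.exists_isReducedEquation
  exact hD.linearFree.notMem_of_surjective hf lieAct (hD.linVF_lieAct_mem_logDer hf)
    hD.card_add_finrank_ker_lieAct_le (exists_lieAct_eq_of_subsingleton_ext hx)

theorem eq_zero_or_one_of_lieAct_apply_eq_zero [Nonempty Q] {e : LieAlg d} (he : IsIdempotentElem e)
    {y : RepSpace Q d} (hy : y ∉ D) (hey : lieAct e y = 0) : e = 0 ∨ e = 1 := by
  have := hD.nontrivial_lieAlg
  obtain ⟨f, hf⟩ := hD.linearFree.1.exists_isReducedEquation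
  obtain ⟨c, rfl⟩ := hD.eq_algebraMap_of_lieAct_eq_zero (hD.linearFree.eq_zero_of_apply_eq_zero hf
    lieAct (hD.linVF_lieAct_mem_logDer hf) hD.card_add_finrank_ker_lieAct_le hy hey)
  rw [IsIdempotentElem, ← map_mul] at he
  have hc : IsIdempotentElem c := FaithfulSMul.algebraMap_injective ℂ (LieAlg d) he
  refine (IsIdempotentElem.iff_eq_zero_or_one.mp hc).imp ?_ ?_
  · rintro rfl
    exact map_zero _
  · rintro rfl
    exact map_one _

theorem exists_pos_trace_lieAct_eq [Nonempty Q] {M : RepSpace Q d} {e : LieAlg d}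
    (he : IsOrthogonalIdempotent M e) :
    ∃ χ : ℝ, 0 < χ ∧ LinearMap.trace ℂ (RepSpace Q d) (lieAct e) = χ := by
  obtain ⟨x₀, hx₀⟩ := hD.discriminant
  obtain ⟨n, hn, hsurj⟩ := he.exists_natCast_eq_trace_lieAct
  refine ⟨n, Nat.cast_pos.mpr (Nat.pos_of_ne_zero fun hzero => ?_), hn⟩
  obtain ⟨y, hy, hey⟩ := he.exists_mem_lieAct_eq_zero (hsurj hzero) hD.linearFree.1.dense_compl
    fun g x hx hxD => hx ((act_mem_iff hx₀ g x).mpr hxD)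
  exact (hD.eq_zero_or_one_of_lieAct_apply_eq_zero he.idem hy hey).elim he.ne_zero he.ne_one

theorem exists_isOrthogonalIdempotent [Nonempty Q] {M : RepSpace Q d} (hM : M ∈ D)
    (hreg : ¬ M.toQRep.IsRegular) : ∃ e, IsOrthogonalIdempotent M e := by
  obtain ⟨x₀, hx₀⟩ := hD.discriminant
  exact RepSpace.exists_isOrthogonalIdempotent
    ((subsingleton_ext_or_hasOrthogonalSplitting hD.sincere
      (hx₀ ▸ hD.linearFree.1.dense_compl) hreg).resolve_left
        fun hext => hD.notMem_of_subsingleton_ext hext hM)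

end DefinesLinearFreeDivisor

theorem mainTheorem5 {Q : Type} [Fintype Q] [DecidableEq Q] [Quiver.{0} Q]
    [∀ i j : Q, Fintype (i ⟶ j)] [∀ i j : Q, DecidableEq (i ⟶ j)]
    (hQ : IsConnectedQuiver Q) (d : Q → ℕ) (D : Set (RepSpace Q d))
    (hD : DefinesLinearFreeDivisor d D)
    (M : RepSpace Q d) (hM : M ∈ D) (hreg : ¬ (RepSpace.toQRep M).IsRegular) :
    IsWeaklyQuasihomogeneousAt D M := by
  have := hQ.1
  obtain ⟨f, hf⟩ := hD.linearFree.1.exists_isReducedEquation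
  obtain ⟨e, he⟩ := hD.exists_isOrthogonalIdempotent hM hreg
  obtain ⟨χ, hχ, htrace⟩ := hD.exists_pos_trace_lieAct_eq he
  obtain ⟨R, hR⟩ := he.exists_isIdempotentElem_lieAct_add_comp
  refine hf.isWeaklyQuasihomogeneousAt hχ (htrace ▸ hD.linVF_lieAct_eq_trace_mul hf e)
    he.lieAct_eq_zero (R := fun i => RepSpace.lieAct (R (Pi.single i 1)))
    (fun _ => hD.linVF_lieAct_mem_logDer hf _)
    (K := RepSpace.lieAct e + RepSpace.lieAct.flip M ∘ₗ R) (fun _ => rfl) fun μ v hv hμ => ?_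
  have hidem : IsIdempotentElem μ := by
    have hsq := LinearMap.congr_fun hR.eq v
    rw [Module.End.mul_apply, hμ, map_smul, hμ, smul_smul] at hsq
    exact smul_left_injective ℂ hv hsq
  rcases IsIdempotentElem.iff_eq_zero_or_one.mp hidem with rfl | rfl
  · exact ⟨0, le_rfl, Complex.ofReal_zero.symm⟩
  · exact ⟨1, zero_le_one, Complex.ofReal_one.symm⟩
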